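/- An L-shape grounded on the $x$-axis is a polygonal line with vertices $(x,0)$, $(x,h)$, $(x',h)$, where $h>0$ and $x'\ne x$; it is square if $|x'-x|=h$. A family of L-shapes may contain both L-shapes that turn right ($x'>x$) and L-shapes that turn left ($x'<x$); it is in general position if no two of its vertical segments lie on the same vertical line and no two of its horizontal segments lie on the same horizontal line. The intersection graph of the family has the L-shapes as vertices, and two of them are adjacent if and only if they have a common point. Theorem. There is an algorithm that, given $n$ grounded two-sided square L-shapes in general position (each given by the real numbers $x,h,x'$), finds a maximum clique of their intersection graph in $O(n^2\log\log n)$ time. The time is counted on a random access machine with unit-cost operations on words of $w$ bits, where $w$ may be any integer that is at least a fixed constant times $\lfloor\log_2 n\rfloor+1$ (with $\log_2 0$ read as $0$), and with unit-cost copying, addition, subtraction and comparison of real numbers. The program and the time bound do not depend on $w$. -/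

import Mathlib

open Asymptotics Filter

/-! ## Grounded square L-shapes and their intersection graphs -/

/-- A grounded L-shape: the polygonal line with vertices `(foot, 0)`, `(foot, height)` and
`(free, height)`. The ground line is the `x`-axis. The shape turns right (clockwise) if
`foot < free` and left (anticlockwise) if `free < foot`. -/
structure GroundedL where
  foot : ℝ
  height : ℝ
  free : ℝ
  height_pos : 0 < height
  free_ne_foot : free ≠ foot

namespace GroundedL

/-- The vertical segment of an L-shape. -/
def vertical (L : GroundedL) : Set (ℝ × ℝ) :=
  segment ℝ (L.foot, 0) (L.foot, L.height)

/-- The horizontal segment of an L-shape. -/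
def horizontal (L : GroundedL) : Set (ℝ × ℝ) :=
  segment ℝ (L.foot, L.height) (L.free, L.height)

/-- The point set of an L-shape. -/
def carrier (L : GroundedL) : Set (ℝ × ℝ) :=
  L.vertical ∪ L.horizontal

/-- An L-shape is square if its horizontal and vertical segments have the same length. -/
def IsSquare (L : GroundedL) : Prop :=
  |L.free - L.foot| = L.height

/-- General position: no two vertical segments lie on the same vertical line, and no two
horizontal segments lie on the same horizontal line. -/
def GeneralPosition {n : ℕ} (S : Fin n → GroundedL) : Prop :=
  ∀ i j, i ≠ j → (S i).foot ≠ (S j).foot ∧ (S i).height ≠ (S j).height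

/-- The intersection graph of a family of L-shapes. -/
def intersectionGraph {n : ℕ} (S : Fin n → GroundedL) : SimpleGraph (Fin n) where
  Adj i j := i ≠ j ∧ ((S i).carrier ∩ (S j).carrier).Nonempty
  symm := ⟨fun _ _ h => ⟨h.1.symm, by rw [Set.inter_comm]; exact h.2⟩⟩
  loopless := ⟨fun _ h => h.1 rfl⟩

end GroundedL

/-! ## A random access machine

The machine works on words of `w` bits and on real numbers. It has word registers, word arrays,
real registers and real arrays; a program names finitely many of each. Reals can be copied,
added, subtracted and compared, but never rounded or converted into words. Every instruction and
every evaluation of a condition takes one unit of time. -/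

namespace RAM

/-- The contents of the registers and of the arrays. -/
structure State where
  reg : ℕ → ℕ
  mem : ℕ → ℕ → ℕ
  rreg : ℕ → ℝ
  rmem : ℕ → ℕ → ℝ

/-- The binary operations on words. -/
inductive WordOp
  | add | sub | mul | div | mod | and | or | xor | shl | shr

/-- The value of a word operation, modulo `2 ^ w` (with `a / 0 = 0` and `a % 0 = a % 2 ^ w`). -/
def WordOp.eval (w : ℕ) : WordOp → ℕ → ℕ → ℕ
  | .add, a, b => (a + b) % 2 ^ w
  | .sub, a, b => (a + (2 ^ w - b % 2 ^ w)) % 2 ^ w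
  | .mul, a, b => (a * b) % 2 ^ w
  | .div, a, b => (a / b) % 2 ^ w
  | .mod, a, b => (a % b) % 2 ^ w
  | .and, a, b => (a &&& b) % 2 ^ w
  | .or, a, b => (a ||| b) % 2 ^ w
  | .xor, a, b => (a ^^^ b) % 2 ^ w
  | .shl, a, b => (a <<< b) % 2 ^ w
  | .shr, a, b => (a >>> b) % 2 ^ w

/-- The elementary instructions. -/
inductive Instr
  /-- do nothing -/
  | nop
  /-- `reg d := c` -/
  | const (d c : ℕ)
  /-- `reg d := reg a` -/
  | move (d a : ℕ)
  /-- `reg d := reg a (op) reg b` -/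
  | op (o : WordOp) (d a b : ℕ)
  /-- `reg d := mem A [reg i]` -/
  | load (d A i : ℕ)
  /-- `mem A [reg i] := reg a` -/
  | store (A i a : ℕ)
  /-- `rreg d := rreg a` -/
  | rmove (d a : ℕ)
  /-- `rreg d := rreg a + rreg b` -/
  | radd (d a b : ℕ)
  /-- `rreg d := rreg a - rreg b` -/
  | rsub (d a b : ℕ)
  /-- `rreg d := rmem A [reg i]` -/
  | rload (d A i : ℕ)
  /-- `rmem A [reg i] := rreg a` -/
  | rstore (A i a : ℕ)

/-- The effect of an instruction on a state, for words of `w` bits. -/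
noncomputable def Instr.run (w : ℕ) : Instr → State → State
  | .nop, s => s
  | .const d c, s => { s with reg := Function.update s.reg d (c % 2 ^ w) }
  | .move d a, s => { s with reg := Function.update s.reg d (s.reg a) }
  | .op o d a b, s => { s with reg := Function.update s.reg d (o.eval w (s.reg a) (s.reg b)) }
  | .load d A i, s => { s with reg := Function.update s.reg d (s.mem A (s.reg i)) }
  | .store A i a, s =>
      { s with mem := Function.update s.mem A (Function.update (s.mem A) (s.reg i) (s.reg a)) }
  | .rmove d a, s => { s with rreg := Function.update s.rreg d (s.rreg a) }
  | .radd d a b, s => { s with rreg := Function.update s.rreg d (s.rreg a + s.rreg b) }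
  | .rsub d a b, s => { s with rreg := Function.update s.rreg d (s.rreg a - s.rreg b) }
  | .rload d A i, s => { s with rreg := Function.update s.rreg d (s.rmem A (s.reg i)) }
  | .rstore A i a, s =>
      { s with rmem := Function.update s.rmem A (Function.update (s.rmem A) (s.reg i) (s.rreg a)) }

/-- The conditions that a program can test: comparisons of two registers. -/
inductive Cond
  | lt (a b : ℕ)
  | eq (a b : ℕ)
  | rlt (a b : ℕ)

/-- The truth of a condition in a state. -/
def Cond.holds : Cond → State → Prop
  | .lt a b, s => s.reg a < s.reg b
  | .eq a b, s => s.reg a = s.reg b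
  | .rlt a b, s => s.rreg a < s.rreg b

/-- Programs. -/
inductive Program
  | instr (i : Instr)
  | seq (p q : Program)
  | ite (c : Cond) (p q : Program)
  | loop (c : Cond) (p : Program)

/-- `Exec w p s t s'`: on words of `w` bits, the program `p`, started in the state `s`, halts
after exactly `t` time units in the state `s'`. The program `loop c p` repeats `p` as long as
`c` holds. -/
inductive Exec (w : ℕ) : Program → State → ℕ → State → Prop
  | instr (i : Instr) (s : State) : Exec w (.instr i) s 1 (i.run w s)
  | seq {p q : Program} {s s₁ s₂ : State} {t₁ t₂ : ℕ} :
      Exec w p s t₁ s₁ → Exec w q s₁ t₂ s₂ → Exec w (.seq p q) s (t₁ + t₂) s₂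
  | ite_true {c : Cond} {p q : Program} {s s₁ : State} {t : ℕ} :
      c.holds s → Exec w p s t s₁ → Exec w (.ite c p q) s (t + 1) s₁
  | ite_false {c : Cond} {p q : Program} {s s₁ : State} {t : ℕ} :
      ¬ c.holds s → Exec w q s t s₁ → Exec w (.ite c p q) s (t + 1) s₁
  | loop_true {c : Cond} {p : Program} {s s₁ s₂ : State} {t₁ t₂ : ℕ} :
      c.holds s → Exec w p s t₁ s₁ → Exec w (.loop c p) s₁ t₂ s₂ →
        Exec w (.loop c p) s (t₁ + t₂ + 1) s₂
  | loop_false {c : Cond} {p : Program} {s : State} :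
      ¬ c.holds s → Exec w (.loop c p) s 1 s

/-- Programs are deterministic: the running time and the final state are unique. -/
theorem Exec.unique {w : ℕ} {p : Program} {s s₁ s₂ : State} {t₁ t₂ : ℕ}
    (h₁ : Exec w p s t₁ s₁) (h₂ : Exec w p s t₂ s₂) : t₁ = t₂ ∧ s₁ = s₂ := by
  induction h₁ generalizing t₂ s₂ with
  | instr i s => cases h₂; exact ⟨rfl, rfl⟩
  | seq _ _ ih₁ ih₂ =>
    cases h₂ with
    | seq a b =>
      obtain ⟨rfl, rfl⟩ := ih₁ a
      obtain ⟨rfl, rfl⟩ := ih₂ b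
      exact ⟨rfl, rfl⟩
  | ite_true hc _ ih =>
    cases h₂ with
    | ite_true _ a => obtain ⟨rfl, rfl⟩ := ih a; exact ⟨rfl, rfl⟩
    | ite_false hn _ => exact absurd hc hn
  | ite_false hc _ ih =>
    cases h₂ with
    | ite_true hn _ => exact absurd hn hc
    | ite_false _ a => obtain ⟨rfl, rfl⟩ := ih a; exact ⟨rfl, rfl⟩
  | loop_true hc _ _ ih₁ ih₂ =>
    cases h₂ with
    | loop_true _ a b =>
      obtain ⟨rfl, rfl⟩ := ih₁ a
      obtain ⟨rfl, rfl⟩ := ih₂ b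
      exact ⟨rfl, rfl⟩
    | loop_false hn => exact absurd hc hn
  | loop_false hc =>
    cases h₂ with
    | loop_true hn _ _ => exact absurd hn hc
    | loop_false _ => exact ⟨rfl, rfl⟩

/-- The input: word register `0` holds the number of L-shapes, and the real arrays `0`, `1`, `2`
hold the `x`-coordinates of the feet, the heights, and the `x`-coordinates of the free endpoints.
Everything else is zero. -/
def input {n : ℕ} (S : Fin n → GroundedL) : State where
  reg r := if r = 0 then n else 0
  mem _ _ := 0
  rreg _ := 0
  rmem A i :=
    if h : i < n then
      if A = 0 then (S ⟨i, h⟩).foot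
      else if A = 1 then (S ⟨i, h⟩).height
      else if A = 2 then (S ⟨i, h⟩).free
      else 0
    else 0

/-- The state `s` outputs the set `Q` of indices: word register `0` holds the size of `Q`, and the
word array `0` starts with a list of the elements of `Q`, without repetition. -/
def Outputs {n : ℕ} (s : State) (Q : Finset (Fin n)) : Prop :=
  s.reg 0 = Q.card ∧ (Finset.range Q.card).image (s.mem 0) = Q.image Fin.val

end RAM

/-! Two L-shapes meet exactly when the horizontal segment of the lower one reaches over the foot of
the higher one (`GroundedL.inter_nonempty_iff`). Let `e` be the lowest member of a clique. All feet
of the clique lie in the window below the horizontal segment of `e`, and the width of this window is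
the height of `e`. Every other member is higher and square, hence at least as wide as the window, so
inside the window it covers everything on the side to which it turns. Cliques with lowest member `e`
thus become nested sets: sets of feet in the window of `e` in which each member has all higher
members on the side that it faces (`cliqueList_spec`, `card_le_cliqueSize`).

Insert the L-shapes by decreasing height, and let `best` give, after `t` insertions, the largest
size of a nested set in the window that omits `a` positions on the left and `b` on the right. A new
shape in the window, with position `p` from the left and `q` from the right, is lower than all
earlier ones. If it turns right, the new value at `(a, b)` is the maximum of the old value there and
one plus the old value at `(p, b)`; if it turns left, `(a, q)` replaces `(p, b)`.

A table over all `(a, b)` would be too large to update in each stage, but one array `A` encodes it.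
Moving the left end of the window over position `k` raises the value by at most one, and does so
exactly when `b` has reached a threshold `A k`; so the value is the window count `cnt n A a b`.
Inserting a shape that turns right is one scan of `A` with a running minimum (`cnt_ins`). The
mirrored thresholds, for the right end, form the partial inverse `B` of `A` (`cnt_dual`), so a shape
that turns left is inserted into `B` by the same scan, and the other array is recomputed as the
inverse.

A stage costs linear time: ranks by counting, one scan, and one evaluation in the window of the new
shape. The rows of `A` are all kept, and comparing consecutive rows recovers an optimal clique,
again in linear time per stage. The total is `O(n ^ 2)`, which lies within the claimed bound. -/

namespace NestedWindow

/-! ### Threshold arrays, their window counts, and insertion of a position. -/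

/-- The number of positions `k` with `a < k ≤ n - b` and `A k ≤ b`. -/
def cnt (n : ℕ) (A : ℕ → ℕ) (a b : ℕ) : ℕ :=
  Nat.count (fun i => a ≤ i ∧ i + b < n ∧ A (i + 1) ≤ b) n

/-- The minimum of `A` on `(k, p]`, and `0` if this interval is empty. -/
noncomputable def runMin (A : ℕ → ℕ) (p k : ℕ) : ℕ := sInf (A '' Set.Ioc k p)

/-- The array obtained from `A` by inserting an element at position `p`. -/
noncomputable def ins (A : ℕ → ℕ) (p k : ℕ) : ℕ := if k = p then 0 else max (A k) (runMin A p k)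

/-- The first position in `(l, n]` at which `A` takes the value `m`, and `0` if there is none. -/
noncomputable def firstPos (n : ℕ) (A : ℕ → ℕ) (l m : ℕ) : ℕ := sInf {k | l < k ∧ k ≤ n ∧ A k = m}

/-- `A` and `B` are inverse to each other as partial maps of `{1, …, n}`, where `0` stands for
an undefined value, and both lie below the antidiagonal. -/
structure Dual (n : ℕ) (A B : ℕ → ℕ) : Prop where
  left_le : ∀ k, 1 ≤ k → k ≤ n → A k + k ≤ n + 1
  right_le : ∀ k, 1 ≤ k → k ≤ n → B k + k ≤ n + 1
  iff : ∀ k m, 1 ≤ k → k ≤ n → 1 ≤ m → m ≤ n → (A k = m ↔ B m = k)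

theorem Dual.symm {n : ℕ} {A B : ℕ → ℕ} (h : Dual n A B) : Dual n B A :=
  ⟨h.right_le, h.left_le, fun k m h1 h2 h3 h4 => (h.iff m k h3 h4 h1 h2).symm⟩

theorem cnt_congr {n : ℕ} {A A' : ℕ → ℕ} {a b : ℕ}
    (h : ∀ k, a < k → k + b ≤ n → (A k ≤ b ↔ A' k ≤ b)) : cnt n A a b = cnt n A' a b := by
  unfold cnt
  congr 1
  ext i
  constructor
  · rintro ⟨h1, h2, h3⟩
    exact ⟨h1, h2, (h (i + 1) (by omega) (by omega)).1 h3⟩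
  · rintro ⟨h1, h2, h3⟩
    exact ⟨h1, h2, (h (i + 1) (by omega) (by omega)).2 h3⟩

/-- This is what makes `A` an array of thresholds for the left end of the window; the inductions
over the left end below use it as their step. -/
theorem cnt_succ_left (n : ℕ) (A : ℕ → ℕ) (a b : ℕ) :
    cnt n A a b = cnt n A (a + 1) b + if a + b < n ∧ A (a + 1) ≤ b then 1 else 0 := by
  unfold cnt
  simp only [Nat.count_eq_card_filter_range]
  split_ifs with h
  · rw [← Finset.card_insert_of_notMem (a := a)]
    · congr 1
      ext i
      simp only [Finset.mem_filter, Finset.mem_range, Finset.mem_insert]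
      constructor
      · rintro ⟨h1, h2, h3⟩
        by_cases hi : i = a
        · exact Or.inl hi
        · exact Or.inr ⟨h1, by omega, h3⟩
      · rintro (rfl | ⟨h1, h2, h3⟩)
        · exact ⟨by omega, le_rfl, h⟩
        · exact ⟨h1, by omega, h3⟩
    · simp
  · rw [add_zero]
    congr 1
    ext i
    simp only [Finset.mem_filter, Finset.mem_range]
    constructor
    · rintro ⟨h1, h2, h3⟩
      refine ⟨h1, ?_, h3⟩
      by_contra hi
      obtain rfl : i = a := by omega
      exact h h3
    · rintro ⟨h1, h2, h3⟩
      exact ⟨h1, by omega, h3⟩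

/-- The positions of the window that are not counted correspond to the pairs `(k, m)` with `A k =
m`, `a < k` and `b < m`, a description that is symmetric under exchanging `A` with `B` and `a` with
`b`. The size of the window is symmetric too. -/
theorem cnt_dual {n : ℕ} {A B : ℕ → ℕ} (h : Dual n A B) (a b : ℕ) :
    cnt n A a b = cnt n B b a := by
  unfold cnt
  simp only [Nat.count_eq_card_filter_range]
  have key : ∀ (A : ℕ → ℕ) (a b : ℕ),
      ((Finset.range n).filter (fun i => a ≤ i ∧ i + b < n ∧ A (i + 1) ≤ b)).card
        + ((Finset.range n).filter (fun i => a ≤ i ∧ i + b < n ∧ b < A (i + 1))).card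
        = n - a - b := by
    intro A a b
    rw [← Finset.card_union_of_disjoint]
    · have : n - a - b = (Finset.Ico a (n - b)).card := by simp; omega
      rw [this]
      congr 1
      ext i
      simp only [Finset.mem_union, Finset.mem_filter, Finset.mem_range, Finset.mem_Ico]
      constructor
      · rintro (⟨h1, h2, h3, -⟩ | ⟨h1, h2, h3, -⟩) <;> omega
      · intro hi
        rcases le_or_gt (A (i + 1)) b with h | h
        · left; omega
        · right; omega
    · rw [Finset.disjoint_filter]
      intro i _ h1 h2
      omega
  -- The index `i` stands for position `i + 1`, hence the shifts by one. The inequalities below the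
  -- antidiagonal place the image inside the other window.
  have bij : ((Finset.range n).filter (fun i => a ≤ i ∧ i + b < n ∧ b < A (i + 1))).card
      = ((Finset.range n).filter (fun i => b ≤ i ∧ i + a < n ∧ a < B (i + 1))).card := by
    refine Finset.card_nbij' (fun i => A (i + 1) - 1) (fun i => B (i + 1) - 1) ?_ ?_ ?_ ?_
    · intro i hi
      simp only [Finset.coe_filter, Finset.mem_range, Set.mem_ofPred_eq] at hi ⊢
      have h1 := h.left_le (i + 1) (by omega) (by omega)
      have h2 := (h.iff (i + 1) (A (i + 1)) (by omega) (by omega) (by omega) (by omega)).1 rfl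
      have : A (i + 1) - 1 + 1 = A (i + 1) := by omega
      rw [this, h2]
      omega
    · intro i hi
      simp only [Finset.coe_filter, Finset.mem_range, Set.mem_ofPred_eq] at hi ⊢
      have h1 := h.right_le (i + 1) (by omega) (by omega)
      have h2 := (h.symm.iff (i + 1) (B (i + 1)) (by omega) (by omega) (by omega) (by omega)).1 rfl
      have : B (i + 1) - 1 + 1 = B (i + 1) := by omega
      rw [this, h2]
      omega
    · intro i hi
      simp only [Finset.coe_filter, Finset.mem_range, Set.mem_ofPred_eq] at hi ⊢
      have h1 := h.left_le (i + 1) (by omega) (by omega)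
      have h2 := (h.iff (i + 1) (A (i + 1)) (by omega) (by omega) (by omega) (by omega)).1 rfl
      have : A (i + 1) - 1 + 1 = A (i + 1) := by omega
      rw [this, h2]
      omega
    · intro i hi
      simp only [Finset.coe_filter, Finset.mem_range, Set.mem_ofPred_eq] at hi ⊢
      have h1 := h.right_le (i + 1) (by omega) (by omega)
      have h2 := (h.symm.iff (i + 1) (B (i + 1)) (by omega) (by omega) (by omega) (by omega)).1 rfl
      have : B (i + 1) - 1 + 1 = B (i + 1) := by omega
      rw [this, h2]
      omega
  have h1 := key A a b
  have h2 := key B b a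
  omega

theorem runMin_of_le {A : ℕ → ℕ} {p k : ℕ} (h : p ≤ k) : runMin A p k = 0 := by
  simp [runMin, Set.Ioc_eq_empty (not_lt.2 h)]

theorem runMin_le {A : ℕ → ℕ} {p k m : ℕ} (h1 : k < m) (h2 : m ≤ p) : runMin A p k ≤ A m :=
  Nat.sInf_le ⟨m, ⟨h1, h2⟩, rfl⟩

theorem exists_eq_runMin {A : ℕ → ℕ} {p k : ℕ} (h : k < p) :
    ∃ m, k < m ∧ m ≤ p ∧ A m = runMin A p k := by
  obtain ⟨m, hm, e⟩ := Nat.sInf_mem (s := A '' Set.Ioc k p) ⟨_, p, ⟨h, le_rfl⟩, rfl⟩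
  exact ⟨m, hm.1, hm.2, e⟩

theorem runMin_self (A : ℕ → ℕ) (p : ℕ) : runMin A (p + 1) p = A (p + 1) := by
  obtain ⟨m, h1, h2, e⟩ := exists_eq_runMin (A := A) (Nat.lt_succ_self p)
  obtain rfl : m = p + 1 := by omega
  exact e.symm

theorem runMin_pred {A : ℕ → ℕ} {p k : ℕ} (h : k + 1 < p) :
    runMin A p k = min (runMin A p (k + 1)) (A (k + 1)) := by
  apply le_antisymm
  · obtain ⟨m, h1, h2, e⟩ := exists_eq_runMin (A := A) h
    exact le_min (e ▸ runMin_le (by omega) h2) (runMin_le (by omega) (by omega))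
  · obtain ⟨m, h1, h2, e⟩ := exists_eq_runMin (A := A) (k := k) (p := p) (by omega)
    rw [← e]
    by_cases hm : m = k + 1
    · exact hm ▸ min_le_right _ _
    · exact (min_le_left _ _).trans (runMin_le (by omega) h2)

theorem ins_self (A : ℕ → ℕ) (p : ℕ) : ins A p p = 0 := by simp [ins]

theorem ins_of_lt {A : ℕ → ℕ} {p k : ℕ} (h : p < k) : ins A p k = A k := by
  simp [ins, h.ne', runMin_of_le h.le]

theorem ins_of_gt {A : ℕ → ℕ} {p k : ℕ} (h : k < p) : ins A p k = max (A k) (runMin A p k) := by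
  simp [ins, h.ne]

theorem cnt_ins_of_le {n : ℕ} {A : ℕ → ℕ} {p a b : ℕ} (h : p ≤ a) :
    cnt n (ins A p) a b = cnt n A a b :=
  cnt_congr fun k hk _ => by rw [ins_of_lt (by omega)]

/-- The window ends to the left of `p`, and there the running minimum is at most `A p = q ≤ b`;
taking the maximum with it cannot lift a threshold above `b`. -/
theorem cnt_ins_of_le' {n : ℕ} {A : ℕ → ℕ} {p q a b : ℕ} (hpq : p + q = n + 1) (hA : A p = q)
    (h : q ≤ b) : cnt n (ins A p) a b = cnt n A a b :=
  cnt_congr fun k hk hk' => by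
    have hkp : k < p := by omega
    have := runMin_le hkp (le_refl p) (A := A)
    rw [ins_of_gt hkp, max_le_iff]
    omega

/-- A conservation law. At each position left of `p` the scan replaces the pair (threshold, carried
minimum) by (maximum, minimum), which preserves how many of the two are at most `b`. The extra `1`
comes from the new threshold `0` at `p`. -/
theorem cnt_ins_add {n : ℕ} {A : ℕ → ℕ} {p q b : ℕ} (hpq : p + q = n + 1) (hA : A p = q)
    (hb : b < q) (d a : ℕ) (h : a + d + 1 = p) :
    cnt n (ins A p) a b + (if runMin A p a ≤ b then 1 else 0) = cnt n A a b + 1 := by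
  induction d generalizing a with
  | zero =>
    obtain rfl : p = a + 1 := by omega
    rw [cnt_succ_left n (ins A _) a b, cnt_succ_left n A a b, ins_self, runMin_self, hA,
      cnt_ins_of_le le_rfl]
    split_ifs <;> omega
  | succ d ih =>
    have := ih (a + 1) (by omega)
    rw [cnt_succ_left n (ins A _) a b, cnt_succ_left n A a b, ins_of_gt (by omega),
      runMin_pred (k := a) (by omega)]
    simp only [max_le_iff, min_le_iff, show a + b < n by omega, true_and]
    split_ifs at this ⊢ <;> omega

/-- If some threshold in `(a, p]` is at most `b`, the old count already exceeds the count beyond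
`p`, and nothing is gained. Otherwise no position in `(a, p]` counts, and the insertion gains one.
By `cnt_ins_add` the new array does exactly this. -/
theorem cnt_ins {n : ℕ} {A : ℕ → ℕ} {p q a b : ℕ} (hpq : p + q = n + 1) (hA : A p = q)
    (ha : a < p) (hb : b < q) :
    cnt n (ins A p) a b = max (cnt n A a b) (1 + cnt n A p b) := by
  obtain ⟨d, hd⟩ : ∃ d, a + d + 1 = p := ⟨p - a - 1, by omega⟩
  have key := cnt_ins_add hpq hA hb d a hd
  have mono : ∀ d a, a + d + 1 = p → cnt n A p b ≤ cnt n A a b ∧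
      (runMin A p a ≤ b → 1 + cnt n A p b ≤ cnt n A a b) ∧
      (b < runMin A p a → cnt n A a b = cnt n A p b) := by
    intro d
    induction d with
    | zero =>
      intro a h
      obtain rfl : p = a + 1 := by omega
      rw [cnt_succ_left n A a b, runMin_self, hA, if_neg (by omega)]
      exact ⟨le_rfl, fun h => by omega, fun _ => rfl⟩
    | succ d ih =>
      intro a h
      obtain ⟨h1, h2, h3⟩ := ih (a + 1) (by omega)
      rw [cnt_succ_left n A a b, runMin_pred (k := a) (by omega)]
      simp only [lt_min_iff, min_le_iff, show a + b < n by omega, true_and]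
      split_ifs <;> refine ⟨by omega, fun h => ?_, fun h => ?_⟩ <;> omega
  obtain ⟨h1, h2, h3⟩ := mono d a hd
  by_cases h : runMin A p a ≤ b
  · rw [if_pos h] at key
    have := h2 h
    omega
  · rw [if_neg h] at key
    have := h3 (by omega)
    omega

/-- Away from `p`, a position either keeps its threshold or receives a larger one, moved from a
position `m` further right where the running minimum is attained. -/
theorem ins_eq_or {A : ℕ → ℕ} {p k : ℕ} (hk : k ≠ p) :
    ins A p k = A k ∨ (k < p ∧ A k < ins A p k ∧ ∃ m, k < m ∧ m ≤ p ∧ A m = ins A p k ∧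
      ∀ l, k < l → l ≤ p → A m ≤ A l) := by
  rcases lt_or_gt_of_ne hk with h | h
  · rw [ins_of_gt h]
    rcases le_or_gt (runMin A p k) (A k) with h' | h'
    · left; exact max_eq_left h'
    · right
      rw [max_eq_right h'.le]
      obtain ⟨m, h1, h2, e⟩ := exists_eq_runMin (A := A) h
      exact ⟨h, h', m, h1, h2, e, fun l h1 h2 => e ▸ runMin_le h1 h2⟩
  · left; exact ins_of_lt h

/-- Insertion only moves values to the left. A position whose value moved away has received another
one, so nonzero values stay distinct and the new array still has a partial inverse. -/
theorem ins_inj {n : ℕ} {A : ℕ → ℕ} {p : ℕ} (hp : p ≤ n)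
    (inj : ∀ k l, 1 ≤ k → k < l → l ≤ n → A k = A l → A k = 0)
    {k l : ℕ} (h1 : 1 ≤ k) (h2 : k < l) (h3 : l ≤ n) (h : ins A p k = ins A p l) :
    ins A p k = 0 := by
  by_cases hk : k = p
  · subst hk; exact ins_self _ _
  by_cases hl : l = p
  · subst hl; rw [h]; exact ins_self _ _
  rcases ins_eq_or (A := A) hk with ek | ⟨hkp, gk, m, hm1, hm2, em, hm3⟩
  · rcases ins_eq_or (A := A) hl with el | ⟨hlp, gl, m, hm1, hm2, em, hm3⟩
    · rw [ek]; exact inj k l h1 h2 h3 (by omega)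
    · rw [ek]; exact inj k m h1 (by omega) (by omega) (by omega)
  · rcases ins_eq_or (A := A) hl with el | ⟨hlp, gl, m', hm1', hm2', em', hm3'⟩
    · rcases lt_trichotomy m l with hml | rfl | hml
      · have := inj m l (by omega) hml h3 (by omega)
        omega
      -- Here `l` is the position from which the value moved to `k`. Since it keeps that value, some
      -- later `m'` has a value at most `A m`; minimality gives equality and `inj` makes the value
      -- `0`, against `A k < ins A p k`.
      · have := hm3
        have e1 : A m = ins A p m := el.symm
        have e2 := ins_of_gt (A := A) (p := p) (k := m) (by omega)
        obtain ⟨m', h4, h5, e⟩ := exists_eq_runMin (A := A) (k := m) (p := p) (by omega)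
        have := hm3 m' (by omega) h5
        have := inj m m' (by omega) h4 (by omega)
        have := le_max_right (A m) (runMin A p m)
        omega
      · have := inj l m (by omega) hml (by omega) (by omega)
        omega
    · have := hm3 l h2 hlp.le
      omega

theorem ins_le {n : ℕ} {A : ℕ → ℕ} {p : ℕ} (hp : p ≤ n)
    (hA : ∀ k, 1 ≤ k → k ≤ n → A k + k ≤ n + 1) {k : ℕ} (h1 : 1 ≤ k) (h2 : k ≤ n) :
    ins A p k + k ≤ n + 1 := by
  by_cases hk : k = p
  · subst hk; rw [ins_self]; omega
  rcases ins_eq_or (A := A) hk with ek | ⟨hkp, gk, m, hm1, hm2, em, hm3⟩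
  · rw [ek]; exact hA k h1 h2
  · have := hA m (by omega) (by omega)
    omega

/-- The infimum of the empty set is `0`, which is never a position beyond `l`; so `0` unambiguously
marks an absent value. -/
theorem firstPos_mem {n : ℕ} {A : ℕ → ℕ} {l m : ℕ} (h : firstPos n A l m ≠ 0) :
    l < firstPos n A l m ∧ firstPos n A l m ≤ n ∧ A (firstPos n A l m) = m := by
  have : {k | l < k ∧ k ≤ n ∧ A k = m}.Nonempty := by
    by_contra hne
    rw [Set.not_nonempty_iff_eq_empty] at hne
    exact h (by rw [firstPos, hne, Nat.sInf_empty])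
  exact Nat.sInf_mem this

theorem firstPos_self (n : ℕ) (A : ℕ → ℕ) (m : ℕ) : firstPos n A n m = 0 := by
  by_contra h
  have := firstPos_mem h
  omega

/-- The rule by which a scan from right to left builds the inverse: each position overwrites the
entry at its value. -/
theorem firstPos_pred {n : ℕ} {A : ℕ → ℕ} {l m : ℕ} (hl : l + 1 ≤ n) :
    firstPos n A l m = if m = A (l + 1) then l + 1 else firstPos n A (l + 1) m := by
  split_ifs with h
  · apply le_antisymm
    · exact Nat.sInf_le ⟨by omega, hl, h.symm⟩
    · have h0 : firstPos n A l m ∈ {k | l < k ∧ k ≤ n ∧ A k = m} :=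
        Nat.sInf_mem ⟨l + 1, by omega, hl, h.symm⟩
      exact h0.1
  · unfold firstPos
    congr 1
    ext k
    simp only [Set.mem_ofPred_eq]
    constructor
    · rintro ⟨h1, h2, h3⟩
      refine ⟨?_, h2, h3⟩
      by_contra hk
      obtain rfl : k = l + 1 := by omega
      exact h h3.symm
    · rintro ⟨h1, h2, h3⟩
      exact ⟨by omega, h2, h3⟩

theorem dual_firstPos {n : ℕ} {A : ℕ → ℕ} (hA : ∀ k, 1 ≤ k → k ≤ n → A k + k ≤ n + 1)
    (inj : ∀ k l, 1 ≤ k → k < l → l ≤ n → A k = A l → A k = 0) :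
    Dual n A (firstPos n A 0) := by
  have main : ∀ k m, 1 ≤ k → k ≤ n → 1 ≤ m → m ≤ n → (A k = m ↔ firstPos n A 0 m = k) := by
    intro k m h1 h2 h3 h4
    constructor
    · intro h
      have h0 : firstPos n A 0 m ∈ {k | 0 < k ∧ k ≤ n ∧ A k = m} :=
        Nat.sInf_mem ⟨k, by omega, h2, h⟩
      obtain ⟨h5, h6, h7⟩ := h0
      rcases lt_trichotomy (firstPos n A 0 m) k with hlt | heq | hlt
      · have := inj _ k h5 hlt h2 (by omega)
        omega
      · exact heq
      · have := inj k _ h1 hlt h6 (by omega)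
        omega
    · intro h
      have := firstPos_mem (n := n) (A := A) (l := 0) (m := m) (by omega)
      rw [h] at this
      exact this.2.2
  refine ⟨hA, ?_, main⟩
  intro m h1 h2
  by_cases h : firstPos n A 0 m = 0
  · omega
  · obtain ⟨h3, h4, h5⟩ := firstPos_mem h
    have := hA _ h3 h4
    omega

theorem Dual.inj {n : ℕ} {A B : ℕ → ℕ} (h : Dual n A B) (k l : ℕ) (h1 : 1 ≤ k) (h2 : k < l)
    (h3 : l ≤ n) (e : A k = A l) : A k = 0 := by
  by_contra h0
  have b := h.left_le k h1 (by omega)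
  have e1 := (h.iff k (A k) h1 (by omega) (by omega) (by omega)).1 rfl
  have e2 := (h.iff l (A k) (by omega) h3 (by omega) (by omega)).1 e.symm
  omega

theorem Dual.ins {n : ℕ} {A B : ℕ → ℕ} (h : Dual n A B) {p : ℕ} (hp : p ≤ n) :
    Dual n (ins A p) (firstPos n (ins A p) 0) :=
  dual_firstPos (fun _ => ins_le hp h.left_le) (fun _ _ => ins_inj hp h.inj)

end NestedWindow

/-! ### Nested sets of points: recurrence, optimality and reconstruction. -/

namespace NestedWindow

/-- A position still to be inserted keeps its initial value on the antidiagonal: to the left of `p`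
that value exceeds `A p`, hence the running minimum. -/
theorem ins_eq_of_ne {n : ℕ} {A : ℕ → ℕ} {p q p' q' : ℕ} (hpq : p + q = n + 1)
    (hpq' : p' + q' = n + 1) (hA : A p = q) (hA' : A p' = q') (h : p' ≠ p) :
    ins A p p' = q' := by
  rcases lt_or_gt_of_ne h with h | h
  · have := runMin_le h (le_refl p) (A := A)
    rw [ins_of_gt h]
    omega
  · rw [ins_of_lt h, hA']

/-- The points `t < n` have position `P t` from the left and `Q t` from the right. -/
structure Layout (n : ℕ) (P Q : ℕ → ℕ) : Prop where
  add : ∀ t < n, P t + Q t = n + 1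
  left_pos : ∀ t < n, 1 ≤ P t
  right_pos : ∀ t < n, 1 ≤ Q t
  inj : ∀ s t, s < n → t < n → P s = P t → s = t

open Classical in
/-- The two dual arrays after the insertion of the first `t` points. The point `t` cuts off
everything to its left if `D t` holds, and everything to its right otherwise. -/
noncomputable def rows (n : ℕ) (P Q : ℕ → ℕ) (D : ℕ → Prop) : ℕ → (ℕ → ℕ) × (ℕ → ℕ)
  | 0 => (fun k => n + 1 - k, fun k => n + 1 - k)
  | t + 1 =>
    if D t then
      (ins (rows n P Q D t).1 (P t), firstPos n (ins (rows n P Q D t).1 (P t)) 0)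
    else
      (firstPos n (ins (rows n P Q D t).2 (Q t)) 0, ins (rows n P Q D t).2 (Q t))

section

variable {n : ℕ} {P Q : ℕ → ℕ} {D : ℕ → Prop}

/-- The second clause supplies the hypothesis `A p = q` of `cnt_ins` at the moment when a point is
inserted. -/
theorem dual_rows (h : Layout n P Q) (t : ℕ) (ht : t ≤ n) :
    Dual n (rows n P Q D t).1 (rows n P Q D t).2 ∧
      ∀ s, t ≤ s → s < n → (rows n P Q D t).1 (P s) = Q s := by
  induction t with
  | zero =>
    refine ⟨⟨?_, ?_, ?_⟩, ?_⟩
    · intro k _ _; simp only [rows]; omega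
    · intro k _ _; simp only [rows]; omega
    · intro k m _ _ _ _; simp only [rows]; omega
    · intro s _ hs
      have := h.add s hs
      simp only [rows]; omega
  | succ t ih =>
    obtain ⟨h1, h2⟩ := ih (by omega)
    have ha := h.add t ht
    have hl := h.left_pos t ht
    have hr := h.right_pos t ht
    have hA := h2 t le_rfl ht
    by_cases hD : D t
    · simp only [rows, if_pos hD]
      refine ⟨h1.ins (by omega), fun s hs hs' => ?_⟩
      exact ins_eq_of_ne ha (h.add s hs') hA (h2 s (by omega) hs')
        fun e => by have := h.inj s t hs' ht e; omega
    · simp only [rows, if_neg hD]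
      have hd := h1.symm.ins (p := Q t) (by omega)
      refine ⟨hd.symm, fun s hs hs' => ?_⟩
      have hsa := h.add s hs'
      have hsl := h.left_pos s hs'
      have hsr := h.right_pos s hs'
      have hB := (h1.iff (P t) (Q t) hl (by omega) hr (by omega)).1 hA
      have hB' := (h1.iff (P s) (Q s) hsl (by omega) hsr (by omega)).1 (h2 s (by omega) hs')
      refine (hd.symm.iff (P s) (Q s) hsl (by omega) hsr (by omega)).2 ?_
      exact ins_eq_of_ne (n := n) (by omega) (by omega) hB hB'
        fun e => by have := h.inj s t hs' ht (by omega); omega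

/-- The greatest size of a nested subset of the first `t` points in the window that omits `a`
positions on the left and `b` positions on the right. -/
noncomputable def best (n : ℕ) (P Q : ℕ → ℕ) (D : ℕ → Prop) (t a b : ℕ) : ℕ :=
  cnt n (rows n P Q D t).1 a b

theorem best_zero (a b : ℕ) : best n P Q D 0 a b = 0 := by
  rw [best, cnt, Nat.count_eq_card_filter_range, Finset.card_eq_zero,
    Finset.filter_eq_empty_iff]
  rintro i - ⟨h1, h2, h3⟩
  simp only [rows] at h3
  omega

theorem best_succ_of_not_mem (h : Layout n P Q) {t a b : ℕ} (ht : t < n)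
    (hab : ¬ (a < P t ∧ b < Q t)) : best n P Q D (t + 1) a b = best n P Q D t a b := by
  obtain ⟨h1, h2⟩ := dual_rows (D := D) h t ht.le
  obtain ⟨h1', -⟩ := dual_rows (D := D) h (t + 1) ht
  have ha := h.add t ht
  have hl := h.left_pos t ht
  have hr := h.right_pos t ht
  have hA := h2 t le_rfl ht
  have hB := (h1.iff (P t) (Q t) hl (by omega) hr (by omega)).1 hA
  by_cases hD : D t
  · simp only [best, rows, if_pos hD]
    rcases le_or_gt (P t) a with hle | hlt
    · exact cnt_ins_of_le hle
    · exact cnt_ins_of_le' ha hA (by omega)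
  · rw [best, best, cnt_dual h1', cnt_dual h1]
    simp only [rows, if_neg hD]
    rcases le_or_gt (Q t) b with hle | hlt
    · exact cnt_ins_of_le hle
    · exact cnt_ins_of_le' (by omega) hB (by omega)

/-- A point that cuts off its right side is handled in the dual array, where `cnt_dual` turns it
into one that cuts off its left side. -/
theorem best_succ_of_mem (h : Layout n P Q) {t a b : ℕ} (ht : t < n)
    (ha : a < P t) (hb : b < Q t) : best n P Q D (t + 1) a b =
      max (best n P Q D t a b) (1 + open Classical in
        if D t then best n P Q D t (P t) b else best n P Q D t a (Q t)) := by
  obtain ⟨h1, h2⟩ := dual_rows (D := D) h t ht.le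
  obtain ⟨h1', -⟩ := dual_rows (D := D) h (t + 1) ht
  have hadd := h.add t ht
  have hl := h.left_pos t ht
  have hr := h.right_pos t ht
  have hA := h2 t le_rfl ht
  have hB := (h1.iff (P t) (Q t) hl (by omega) hr (by omega)).1 hA
  by_cases hD : D t
  · simp only [best, rows, if_pos hD]
    exact cnt_ins hadd hA ha hb
  · simp only [if_neg hD, best]
    rw [cnt_dual h1', cnt_dual h1, cnt_dual h1]
    simp only [rows, if_neg hD]
    exact cnt_ins (by omega) hB hb ha

/-- The point `s'` lies in the window that remains after `s` has been chosen. -/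
def Keeps (P Q : ℕ → ℕ) (D : ℕ → Prop) (s s' : ℕ) : Prop :=
  (D s → P s < P s') ∧ (¬ D s → Q s < Q s')

/-- If the last point `t` belongs to `X`, it forces all other points of `X` into the window that it
leaves, so induction applies to `X.erase t` and the recurrence adds one. -/
theorem card_le_best (h : Layout n P Q) (t : ℕ) (ht : t ≤ n) (a b : ℕ) (X : Finset ℕ)
    (hX : ∀ s ∈ X, s < t ∧ a < P s ∧ b < Q s)
    (hK : ∀ s ∈ X, ∀ s' ∈ X, s' < s → Keeps P Q D s s') : X.card ≤ best n P Q D t a b := by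
  induction t generalizing a b X with
  | zero =>
    have : X = ∅ := Finset.eq_empty_of_forall_notMem fun s hs => by have := hX s hs; omega
    simp [this]
  | succ t ih =>
    by_cases htX : t ∈ X
    · obtain ⟨-, ha, hb⟩ := hX t htX
      rw [best_succ_of_mem h ht ha hb, ← Finset.card_erase_add_one htX]
      have hlt : ∀ s ∈ X.erase t, s < t := fun s hs => by
        have := hX s (Finset.mem_of_mem_erase hs)
        have := Finset.ne_of_mem_erase hs
        omega
      have hK' : ∀ s ∈ X.erase t, ∀ s' ∈ X.erase t, s' < s → Keeps P Q D s s' :=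
        fun s hs s' hs' => hK s (Finset.mem_of_mem_erase hs) s' (Finset.mem_of_mem_erase hs')
      by_cases hD : D t
      · have := ih (by omega) (P t) b (X.erase t) (fun s hs => ⟨hlt s hs,
          (hK t htX s (Finset.mem_of_mem_erase hs) (hlt s hs)).1 hD,
          (hX s (Finset.mem_of_mem_erase hs)).2.2⟩) hK'
        rw [if_pos hD]
        omega
      · have := ih (by omega) a (Q t) (X.erase t) (fun s hs => ⟨hlt s hs,
          (hX s (Finset.mem_of_mem_erase hs)).2.1,
          (hK t htX s (Finset.mem_of_mem_erase hs) (hlt s hs)).2 hD⟩) hK'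
        rw [if_neg hD]
        omega
    · have := ih (by omega) a b X (fun s hs => ⟨by
        have := hX s hs
        have : s ≠ t := fun e => htX (e ▸ hs)
        omega, (hX s hs).2⟩) hK
      by_cases hab : a < P t ∧ b < Q t
      · rw [best_succ_of_mem h ht hab.1 hab.2]
        omega
      · rwa [best_succ_of_not_mem h ht hab]

open Classical in
/-- A largest nested subset of the first `t` points in a window, in decreasing order. -/
noncomputable def back (n : ℕ) (P Q : ℕ → ℕ) (D : ℕ → Prop) : ℕ → ℕ → ℕ → List ℕ
  | 0, _, _ => []
  | t + 1, a, b =>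
    if best n P Q D (t + 1) a b = best n P Q D t a b then back n P Q D t a b
    else t :: back n P Q D t (if D t then P t else a) (if D t then b else Q t)

theorem back_spec (h : Layout n P Q) (t : ℕ) (ht : t ≤ n) (a b : ℕ) :
    (back n P Q D t a b).length = best n P Q D t a b ∧
    (∀ s ∈ back n P Q D t a b, s < t ∧ a < P s ∧ b < Q s) ∧
    (back n P Q D t a b).Pairwise (fun s s' => s' < s ∧ Keeps P Q D s s') := by
  classical
  induction t generalizing a b with
  | zero => simp [back, best_zero]
  | succ t ih =>
    by_cases he : best n P Q D (t + 1) a b = best n P Q D t a b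
    · rw [back, if_pos he, he]
      obtain ⟨h1, h2, h3⟩ := ih (by omega) a b
      exact ⟨h1, fun s hs => ⟨by have := h2 s hs; omega, (h2 s hs).2⟩, h3⟩
    · rw [back, if_neg he]
      -- The value has changed, so the point `t` must lie in the window.
      have hab : a < P t ∧ b < Q t := by
        by_contra hab
        exact he (best_succ_of_not_mem h ht hab)
      obtain ⟨h1, h2, h3⟩ := ih (by omega) (if D t then P t else a) (if D t then b else Q t)
      have hb := best_succ_of_mem (D := D) h ht hab.1 hab.2
      refine ⟨?_, ?_, ?_⟩
      · rw [List.length_cons, h1]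
        by_cases hD : D t
        · simp only [if_pos hD] at hb ⊢
          omega
        · simp only [if_neg hD] at hb ⊢
          omega
      · intro s hs
        rcases List.mem_cons.1 hs with rfl | hs
        · exact ⟨by omega, hab⟩
        · obtain ⟨h4, h5, h6⟩ := h2 s hs
          by_cases hD : D t
          · simp only [if_pos hD] at h5 h6
            exact ⟨by omega, by omega, h6⟩
          · simp only [if_neg hD] at h5 h6
            exact ⟨by omega, h5, by omega⟩
      · refine List.pairwise_cons.2 ⟨fun s hs => ?_, h3⟩
        obtain ⟨h4, h5, h6⟩ := h2 s hs
        refine ⟨h4, fun hD => ?_, fun hD => ?_⟩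
        · rwa [if_pos hD] at h5
        · rwa [if_neg hD] at h6

end

end NestedWindow

/-! ### Ranks by counting. -/

namespace NestedWindow

section Rank

variable {α : Type*} [LinearOrder α]

/-- The number of indices below `n` at which `F` is less than `c`. -/
def countBelow (n : ℕ) (F : ℕ → α) (c : α) : ℕ := Nat.count (fun j => F j < c) n

/-- The number of indices below `n` at which `F` is greater than `c`. -/
def countAbove (n : ℕ) (F : ℕ → α) (c : α) : ℕ := Nat.count (fun j => c < F j) n

/-- Counting is monotone in the bound, and strictly so when the bound passes a value `F i`, since
`i` itself is then counted. The other bound `c` may be arbitrary, which is needed for free ends. -/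
theorem countBelow_le_iff {n : ℕ} {F : ℕ → α} {c : α} {i : ℕ} (hi : i < n) :
    countBelow n F c ≤ countBelow n F (F i) ↔ c ≤ F i := by
  unfold countBelow
  simp only [Nat.count_eq_card_filter_range]
  constructor
  · intro h
    by_contra hc
    rw [not_le] at hc
    refine absurd h (not_le.2 (Finset.card_lt_card ?_))
    rw [Finset.ssubset_iff_of_subset]
    · exact ⟨i, by simp [hi, hc], by simp⟩
    · intro j
      simp only [Finset.mem_filter]
      exact fun hj => ⟨hj.1, hj.2.trans hc⟩
  · intro h
    apply Finset.card_le_card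
    intro j
    simp only [Finset.mem_filter]
    exact fun hj => ⟨hj.1, hj.2.trans_le h⟩

theorem countAbove_le_iff {n : ℕ} {F : ℕ → α} {c : α} {i : ℕ} (hi : i < n) :
    countAbove n F c ≤ countAbove n F (F i) ↔ F i ≤ c := by
  simpa [countBelow, countAbove] using
    countBelow_le_iff (F := fun j => OrderDual.toDual (F j)) (c := OrderDual.toDual c) hi

theorem countBelow_lt_iff {n : ℕ} {F : ℕ → α} {c : α} {i : ℕ} (hi : i < n) :
    countBelow n F (F i) < countBelow n F c ↔ F i < c := by
  rw [← not_le, countBelow_le_iff hi, not_le]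

theorem countAbove_lt_iff {n : ℕ} {F : ℕ → α} {c : α} {i : ℕ} (hi : i < n) :
    countAbove n F (F i) < countAbove n F c ↔ c < F i := by
  rw [← not_le, countAbove_le_iff hi, not_le]

theorem countBelow_add_countAbove {n : ℕ} {F : ℕ → α}
    (hF : ∀ i j, i < n → j < n → F i = F j → i = j) {i : ℕ} (hi : i < n) :
    countBelow n F (F i) + countAbove n F (F i) + 1 = n := by
  unfold countBelow countAbove
  simp only [Nat.count_eq_card_filter_range]
  rw [← Finset.card_union_of_disjoint, ← Finset.card_insert_of_notMem (a := i)]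
  · conv_rhs => rw [← Finset.card_range n]
    congr 1
    ext j
    simp only [Finset.mem_insert, Finset.mem_union, Finset.mem_filter, Finset.mem_range]
    constructor
    · rintro (rfl | h | h)
      · exact hi
      · exact h.1
      · exact h.1
    · intro hj
      rcases lt_trichotomy (F j) (F i) with h | h | h
      · exact Or.inr (Or.inl ⟨hj, h⟩)
      · exact Or.inl (hF j i hj hi h)
      · exact Or.inr (Or.inr ⟨hj, h⟩)
  · simp
  · rw [Finset.disjoint_filter]
    exact fun j _ h1 h2 => lt_asymm h1 h2

theorem countAbove_lt {n : ℕ} {F : ℕ → α} {i : ℕ} (hi : i < n) : countAbove n F (F i) < n := by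
  unfold countAbove
  rw [Nat.count_eq_card_filter_range]
  conv_rhs => rw [← Finset.card_range n]
  apply Finset.card_lt_card
  rw [Finset.ssubset_iff_of_subset (Finset.filter_subset _ _)]
  exact ⟨i, by simp [hi], by simp⟩

theorem countBelow_le (n : ℕ) (F : ℕ → α) (c : α) : countBelow n F c ≤ n := Nat.count_le _

theorem countAbove_le (n : ℕ) (F : ℕ → α) (c : α) : countAbove n F c ≤ n := Nat.count_le _

/-- Every number below `n` is the decreasing rank of exactly one index. -/
theorem exists_countAbove_eq {n : ℕ} {F : ℕ → α}
    (hF : ∀ i j, i < n → j < n → F i = F j → i = j) {t : ℕ} (ht : t < n) :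
    ∃ i < n, countAbove n F (F i) = t := by
  let g : Fin n → Fin n := fun i => ⟨countAbove n F (F i), countAbove_lt i.2⟩
  have hg : Function.Injective g := by
    intro i j hij
    have h : countAbove n F (F i) = countAbove n F (F j) := congrArg Fin.val hij
    apply Fin.ext
    apply hF i j i.2 j.2
    exact le_antisymm ((countAbove_le_iff i.2).1 h.ge) ((countAbove_le_iff j.2).1 h.le)
  obtain ⟨i, hi⟩ := Finite.surjective_of_injective hg ⟨t, ht⟩
  exact ⟨i, i.2, congrArg Fin.val hi⟩

end Rank

end NestedWindow

/-! ### When two L-shapes meet. -/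

namespace GroundedL

theorem mem_vertical {L : GroundedL} {z : ℝ × ℝ} :
    z ∈ L.vertical ↔ z.1 = L.foot ∧ 0 ≤ z.2 ∧ z.2 ≤ L.height := by
  rw [vertical, ← Prod.image_mk_segment_right, segment_eq_uIcc, Set.uIcc_of_le L.height_pos.le]
  obtain ⟨x, y⟩ := z
  simp only [Set.mem_image, Set.mem_Icc, Prod.mk.injEq]
  constructor
  · rintro ⟨v, hv, rfl, rfl⟩; exact ⟨rfl, hv⟩
  · rintro ⟨rfl, hv⟩; exact ⟨y, hv, rfl, rfl⟩

theorem mem_horizontal {L : GroundedL} {z : ℝ × ℝ} :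
    z ∈ L.horizontal ↔ z.2 = L.height ∧ min L.foot L.free ≤ z.1 ∧ z.1 ≤ max L.foot L.free := by
  rw [horizontal, ← Prod.image_mk_segment_left, segment_eq_uIcc]
  obtain ⟨x, y⟩ := z
  simp only [Set.mem_image, Set.uIcc, Set.mem_Icc, Prod.mk.injEq]
  constructor
  · rintro ⟨v, hv, rfl, rfl⟩; exact ⟨rfl, hv⟩
  · rintro ⟨rfl, hv⟩; exact ⟨x, hv, rfl, rfl⟩

/-- Two L-shapes on different vertical lines meet if and only if the horizontal segment of the
lower one meets the vertical segment of the higher one. -/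
theorem inter_nonempty_iff {L M : GroundedL} (hx : L.foot ≠ M.foot) (hh : L.height < M.height) :
    (L.carrier ∩ M.carrier).Nonempty ↔
      min L.foot L.free ≤ M.foot ∧ M.foot ≤ max L.foot L.free := by
  have := L.height_pos
  constructor
  · rintro ⟨z, hL, hM⟩
    simp only [carrier, Set.mem_union, mem_vertical, mem_horizontal] at hL hM
    rcases hL with hL | hL <;> rcases hM with hM | hM
    · exact absurd (hL.1.symm.trans hM.1) hx
    · linarith [hL.2.2, hM.1]
    · rw [← hM.1]; exact hL.2
    · linarith [hL.1, hM.1]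
  · intro h
    refine ⟨(M.foot, L.height), Or.inr (mem_horizontal.2 ⟨rfl, h⟩), Or.inl (mem_vertical.2 ⟨rfl, ?_⟩)⟩
    exact ⟨this.le, hh.le⟩

end GroundedL

/-! ### Cliques of square L-shapes as nested sets. -/

namespace NestedWindow

/-- The feet `F`, heights `H` and free ends `E` of `n` square L-shapes in general position. -/
structure Family (n : ℕ) (F H E : ℕ → ℝ) : Prop where
  free_ne : ∀ i < n, E i ≠ F i
  square : ∀ i < n, |E i - F i| = H i
  foot_inj : ∀ i j, i < n → j < n → F i = F j → i = j
  height_inj : ∀ i j, i < n → j < n → H i = H j → i = j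

/-- The foot of `j` lies below the horizontal segment of `i`. -/
def Meets (F E : ℕ → ℝ) (i j : ℕ) : Prop := min (F i) (E i) ≤ F j ∧ F j ≤ max (F i) (E i)

/-- The position from the left of the `t`-th L-shape in the order `o`. -/
noncomputable def posLeft (n : ℕ) (F : ℕ → ℝ) (o : ℕ → ℕ) (t : ℕ) : ℕ := countBelow n F (F (o t)) + 1

/-- The position from the right of the `t`-th L-shape in the order `o`. -/
noncomputable def posRight (n : ℕ) (F : ℕ → ℝ) (o : ℕ → ℕ) (t : ℕ) : ℕ := countAbove n F (F (o t)) + 1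

/-- The number of feet to the left of the L-shape `i`. -/
noncomputable def cutLeft (n : ℕ) (F E : ℕ → ℝ) (i : ℕ) : ℕ := countBelow n F (min (F i) (E i))

/-- The number of feet to the right of the L-shape `i`. -/
noncomputable def cutRight (n : ℕ) (F E : ℕ → ℝ) (i : ℕ) : ℕ := countAbove n F (max (F i) (E i))

/-- The `t`-th L-shape in the order `o` turns right. -/
def TurnsRight (F E : ℕ → ℝ) (o : ℕ → ℕ) (t : ℕ) : Prop := F (o t) < E (o t)

/-- `o` lists the indices below `n` by decreasing height. -/
structure Sorts (n : ℕ) (H : ℕ → ℝ) (o : ℕ → ℕ) : Prop where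
  rank_lt : ∀ i < n, o (countAbove n H (H i)) = i
  lt : ∀ t < n, o t < n
  rank : ∀ t < n, countAbove n H (H (o t)) = t

/-- The maximum size of a clique whose lowest L-shape is the `t`-th one in the order `o`. -/
noncomputable def cliqueSize (n : ℕ) (F E : ℕ → ℝ) (o : ℕ → ℕ) (t : ℕ) : ℕ :=
  best n (posLeft n F o) (posRight n F o) (TurnsRight F E o) (t + 1)
    (cutLeft n F E (o t)) (cutRight n F E (o t))

/-- A clique of maximum size among those whose lowest L-shape is the `t`-th one in the order `o`. -/
noncomputable def cliqueList (n : ℕ) (F E : ℕ → ℝ) (o : ℕ → ℕ) (t : ℕ) : List ℕ :=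
  (back n (posLeft n F o) (posRight n F o) (TurnsRight F E o) (t + 1)
    (cutLeft n F E (o t)) (cutRight n F E (o t))).map o

variable {n : ℕ} {F H E : ℕ → ℝ} {o : ℕ → ℕ}

/-- By pigeonhole every stage is the rank of some index, so a left inverse of the ranking is also a
right inverse. -/
theorem Sorts.of_rank (hH : ∀ i j, i < n → j < n → H i = H j → i = j)
    (h : ∀ i < n, o (countAbove n H (H i)) = i) : Sorts n H o := by
  refine ⟨h, fun t ht => ?_, fun t ht => ?_⟩ <;>
  · obtain ⟨i, hi, rfl⟩ := exists_countAbove_eq hH ht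
    rw [h i hi]
    try exact hi

theorem Sorts.lt_iff (h : Sorts n H o) {s t : ℕ} (hs : s < n) (ht : t < n) :
    H (o s) < H (o t) ↔ t < s := by
  rw [← countAbove_lt_iff (h.lt t ht), h.rank t ht, h.rank s hs]

theorem layout (hF : Family n F H E) (h : Sorts n H o) :
    Layout n (posLeft n F o) (posRight n F o) := by
  refine ⟨fun t ht => ?_, fun t _ => Nat.le_add_left _ _, fun t _ => Nat.le_add_left _ _,
    fun s t hs ht e => ?_⟩
  · have := countBelow_add_countAbove hF.foot_inj (h.lt t ht)
    unfold posLeft posRight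
    omega
  · have e : countBelow n F (F (o s)) = countBelow n F (F (o t)) := Nat.succ_injective e
    have hst : o s = o t := hF.foot_inj _ _ (h.lt s hs) (h.lt t ht)
      (le_antisymm ((countBelow_le_iff (h.lt t ht)).1 e.le)
        ((countBelow_le_iff (h.lt s hs)).1 e.ge))
    rw [← h.rank s hs, hst, h.rank t ht]

/-- Comparing ranks decides whether a foot lies below a horizontal segment, although the free end of
that segment need not be a foot. -/
theorem mem_window_iff (h : Sorts n H o) {s i : ℕ} (hs : s < n) :
    (cutLeft n F E i < posLeft n F o s ∧ cutRight n F E i < posRight n F o s) ↔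
      Meets F E i (o s) := by
  unfold cutLeft cutRight posLeft posRight Meets
  rw [Nat.lt_succ_iff, Nat.lt_succ_iff, countBelow_le_iff (h.lt s hs),
    countAbove_le_iff (h.lt s hs)]

theorem keeps_iff (h : Sorts n H o) {s s' : ℕ} (hs : s < n) :
    Keeps (posLeft n F o) (posRight n F o) (TurnsRight F E o) s s' ↔
      (F (o s) < E (o s) → F (o s) < F (o s')) ∧ (¬ F (o s) < E (o s) → F (o s') < F (o s)) := by
  unfold Keeps posLeft posRight TurnsRight
  rw [Nat.add_lt_add_iff_right, Nat.add_lt_add_iff_right, countBelow_lt_iff (h.lt s hs),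
    countAbove_lt_iff (h.lt s hs)]

/-- Squareness enters here: each listed shape is at least as high, hence as wide, as the window, so
it reaches every foot of the window on the side it faces. Whether `t` itself is listed plays no
role. -/
theorem cliqueList_spec (hF : Family n F H E) (h : Sorts n H o) {t : ℕ} (ht : t < n) :
    (cliqueList n F E o t).length = cliqueSize n F E o t ∧ (cliqueList n F E o t).Nodup ∧
      (∀ i ∈ cliqueList n F E o t, i < n) ∧
      ∀ i ∈ cliqueList n F E o t, ∀ j ∈ cliqueList n F E o t, H i < H j → Meets F E i j := by
  obtain ⟨h1, h2, h3⟩ := back_spec (D := TurnsRight F E o) (layout hF h) (t + 1) ht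
    (cutLeft n F E (o t)) (cutRight n F E (o t))
  unfold cliqueList cliqueSize
  set L := back n (posLeft n F o) (posRight n F o) (TurnsRight F E o) (t + 1)
    (cutLeft n F E (o t)) (cutRight n F E (o t))
  have hlt : ∀ s ∈ L, s < n := fun s hs => by have := h2 s hs; omega
  refine ⟨by rw [List.length_map, h1], ?_, ?_, ?_⟩
  · rw [List.Nodup, List.pairwise_map]
    refine h3.imp_of_mem fun {s s'} hs hs' hss e => ?_
    have := congrArg (fun i => countAbove n H (H i)) e
    simp only [h.rank s (hlt s hs), h.rank s' (hlt s' hs')] at this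
    omega
  · intro i hi
    obtain ⟨s, hs, rfl⟩ := List.mem_map.1 hi
    exact h.lt s (hlt s hs)
  · intro i hi j hj hij
    obtain ⟨s, hs, rfl⟩ := List.mem_map.1 hi
    obtain ⟨s', hs', rfl⟩ := List.mem_map.1 hj
    have hss := (h.lt_iff (hlt s hs) (hlt s' hs')).1 hij
    -- The list gives the relation only in list order. Made conditional on `s' < s`, it holds in
    -- both orders, vacuously in one of them.
    have hk : Keeps (posLeft n F o) (posRight n F o) (TurnsRight F E o) s s' :=
      List.Pairwise.forall_of_forall_of_flip (l := L)
        (R := fun s s' => s' < s → Keeps (posLeft n F o) (posRight n F o) (TurnsRight F E o) s s')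
        (fun _ _ h => absurd h (lt_irrefl _)) (h3.imp fun h _ => h.2)
        (h3.imp fun h h' => absurd h' (lt_asymm h.1)) hs hs' hss
    rw [keeps_iff h (hlt s hs)] at hk
    have hw := (mem_window_iff h (hlt s hs)).1 (h2 s hs).2
    have hw' := (mem_window_iff h (hlt s' hs')).1 (h2 s' hs').2
    have hHs : H (o t) ≤ H (o s) := by
      by_contra hc
      have := (h.lt_iff (hlt s hs) ht).1 (not_le.1 hc)
      have := h2 s hs
      omega
    have sq := hF.square _ (h.lt t ht)
    have sqs := hF.square _ (h.lt s (hlt s hs))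
    unfold Meets at hw hw' ⊢
    -- The window is as wide as its L-shape is high; together with `hHs`, linear arithmetic then
    -- shows that the segment of `o s` cannot end before the foot of `o s'`.
    have wid : max (F (o t)) (E (o t)) - min (F (o t)) (E (o t)) = H (o t) := by
      rw [← sq, abs_sub_comm]; exact max_sub_min_eq_abs' _ _
    by_cases hD : F (o s) < E (o s)
    · have hk1 := hk.1 hD
      rw [abs_of_pos (by linarith)] at sqs
      rw [min_eq_left hD.le, max_eq_right hD.le]
      constructor <;> linarith [hw.1, hw.2, hw'.1, hw'.2]
    · have hk1 := hk.2 hD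
      have hD := not_lt.1 hD
      rw [abs_of_nonpos (by linarith)] at sqs
      rw [min_eq_right hD, max_eq_left hD]
      constructor <;> linarith [hw.1, hw.2, hw'.1, hw'.2]

/-- The lowest member `e` has the largest rank, so `X` lies within the first `r e + 1` stages and in
the window of `e`. The strict inequalities in `Keeps` come from the distinctness of the feet. -/
theorem card_le_cliqueSize (hF : Family n F H E) (h : Sorts n H o) (X : Finset ℕ)
    (hX : ∀ i ∈ X, i < n) (hM : ∀ i ∈ X, ∀ j ∈ X, H i < H j → Meets F E i j)
    (hne : X.Nonempty) : ∃ t < n, X.card ≤ cliqueSize n F E o t := by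
  obtain ⟨e, he, hmin⟩ := X.exists_min_image H hne
  set r : ℕ → ℕ := fun i => countAbove n H (H i) with hr
  have ho : ∀ i ∈ X, o (r i) = i := fun i hi => h.rank_lt i (hX i hi)
  have hrn : ∀ i ∈ X, r i < n := fun i hi => countAbove_lt (hX i hi)
  refine ⟨r e, hrn e he, ?_⟩
  have hcard : (X.image r).card = X.card := Finset.card_image_of_injOn fun i hi j hj hij => by
    rw [← ho i hi, ← ho j hj, hij]
  rw [← hcard]
  refine card_le_best (layout hF h) _ (hrn e he) _ _ _ ?_ ?_
  · intro s hs
    obtain ⟨i, hi, rfl⟩ := Finset.mem_image.1 hs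
    refine ⟨Nat.lt_succ_iff.2 ((countAbove_le_iff (hX e he)).2 (hmin i hi)), ?_⟩
    rw [mem_window_iff h (hrn i hi), ho i hi, ho e he]
    -- Equal heights mean that `i` is `e`, whose foot lies in its own window.
    rcases (hmin i hi).lt_or_eq with hlt | heq
    · exact hM e he i hi hlt
    · rw [hF.height_inj e i (hX e he) (hX i hi) heq]
      exact ⟨min_le_left _ _, le_max_left _ _⟩
  · intro s hs s' hs' hss
    obtain ⟨i, hi, rfl⟩ := Finset.mem_image.1 hs
    obtain ⟨j, hj, rfl⟩ := Finset.mem_image.1 hs'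
    rw [keeps_iff h (hrn i hi), ho i hi, ho j hj]
    have hij : H i < H j := (countAbove_lt_iff (hX j hj)).1 hss
    have hne : F i ≠ F j := fun e => by
      rw [hF.foot_inj i j (hX i hi) (hX j hj) e] at hij
      exact lt_irrefl _ hij
    have hm := hM i hi j hj hij
    unfold Meets at hm
    constructor
    · intro hD
      rw [min_eq_left hD.le] at hm
      exact lt_of_le_of_ne hm.1 hne
    · intro hD
      rw [max_eq_left (not_lt.1 hD)] at hm
      exact lt_of_le_of_ne hm.2 hne.symm

end NestedWindow

namespace RAM

/-! ### Costs, write sets and a program logic -/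

namespace State

/-- Assign a value to a word register. -/
def setReg (s : State) (d v : ℕ) : State := { s with reg := Function.update s.reg d v }

/-- Assign a value to an entry of a word array. -/
def setMem (s : State) (A i v : ℕ) : State :=
  { s with mem := Function.update s.mem A (Function.update (s.mem A) i v) }

/-- Assign a value to a real register. -/
noncomputable def setRReg (s : State) (d : ℕ) (v : ℝ) : State :=
  { s with rreg := Function.update s.rreg d v }

variable (s : State) (d v A i r B j : ℕ) (x : ℝ)

@[simp] theorem setReg_reg : (s.setReg d v).reg r = if r = d then v else s.reg r :=
  Function.update_apply ..
@[simp] theorem setReg_mem : (s.setReg d v).mem = s.mem := rfl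
@[simp] theorem setReg_rreg : (s.setReg d v).rreg = s.rreg := rfl
@[simp] theorem setReg_rmem : (s.setReg d v).rmem = s.rmem := rfl
@[simp] theorem setMem_reg : (s.setMem A i v).reg = s.reg := rfl
@[simp] theorem setMem_mem :
    (s.setMem A i v).mem B j = if B = A ∧ j = i then v else s.mem B j := by
  simp only [setMem, Function.update_apply]
  by_cases h : B = A
  · subst h; simp [Function.update_apply]
  · simp [h]
@[simp] theorem setMem_rreg : (s.setMem A i v).rreg = s.rreg := rfl
@[simp] theorem setMem_rmem : (s.setMem A i v).rmem = s.rmem := rfl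
@[simp] theorem setRReg_reg : (s.setRReg d x).reg = s.reg := rfl
@[simp] theorem setRReg_mem : (s.setRReg d x).mem = s.mem := rfl
@[simp] theorem setRReg_rreg : (s.setRReg d x).rreg r = if r = d then x else s.rreg r :=
  Function.update_apply ..
@[simp] theorem setRReg_rmem : (s.setRReg d x).rmem = s.rmem := rfl

end State

namespace Program

/-- A bound on the running time if every loop is repeated at most `n` times. -/
def cost (n : ℕ) : Program → ℕ
  | instr _ => 1
  | seq p q => cost n p + cost n q
  | ite _ p q => cost n p + cost n q + 1
  | loop _ p => n * (cost n p + 1) + 1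

/-- The nesting depth of the loops. -/
def depth : Program → ℕ
  | instr _ => 0
  | seq p q => max (depth p) (depth q)
  | ite _ p q => max (depth p) (depth q)
  | loop _ p => depth p + 1

theorem exists_cost_le (p : Program) : ∃ K, ∀ n, p.cost n ≤ K * (n + 1) ^ p.depth := by
  have aux : ∀ {K n d d' : ℕ}, d ≤ d' → K * (n + 1) ^ d ≤ K * (n + 1) ^ d' := fun h =>
    Nat.mul_le_mul_left _ (Nat.pow_le_pow_right (Nat.succ_pos _) h)
  have one : ∀ n d : ℕ, 1 ≤ (n + 1) ^ d := fun n d => Nat.one_le_pow _ _ (Nat.succ_pos _)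
  induction p with
  | instr i => exact ⟨1, fun n => by simp [cost, depth]⟩
  | seq p q hp hq =>
    obtain ⟨K, hK⟩ := hp
    obtain ⟨K', hK'⟩ := hq
    refine ⟨K + K', fun n => ?_⟩
    rw [cost, add_mul]
    exact add_le_add ((hK n).trans (aux (le_max_left _ _))) ((hK' n).trans (aux (le_max_right _ _)))
  | ite c p q hp hq =>
    obtain ⟨K, hK⟩ := hp
    obtain ⟨K', hK'⟩ := hq
    refine ⟨K + K' + 1, fun n => ?_⟩
    rw [cost, add_mul, add_mul, one_mul]
    exact add_le_add (add_le_add ((hK n).trans (aux (le_max_left _ _)))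
      ((hK' n).trans (aux (le_max_right _ _)))) (one _ _)
  | loop c p hp =>
    obtain ⟨K, hK⟩ := hp
    refine ⟨K + 2, fun n => ?_⟩
    rw [cost, depth, pow_succ]
    have h1 := hK n
    have h2 := one n p.depth
    nlinarith

/-- The word register `r` occurs as a target in the program. -/
def setsReg (r : ℕ) : Program → Bool
  | instr (.const d _) => r == d
  | instr (.move d _) => r == d
  | instr (.op _ d _ _) => r == d
  | instr (.load d _ _) => r == d
  | instr _ => false
  | seq p q => setsReg r p || setsReg r q
  | ite _ p q => setsReg r p || setsReg r q
  | loop _ p => setsReg r p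

/-- The word array `A` occurs as a target in the program. -/
def setsMem (A : ℕ) : Program → Bool
  | instr (.store B _ _) => A == B
  | instr _ => false
  | seq p q => setsMem A p || setsMem A q
  | ite _ p q => setsMem A p || setsMem A q
  | loop _ p => setsMem A p

/-- The real register `r` occurs as a target in the program. -/
def setsRReg (r : ℕ) : Program → Bool
  | instr (.rmove d _) => r == d
  | instr (.radd d _ _) => r == d
  | instr (.rsub d _ _) => r == d
  | instr (.rload d _ _) => r == d
  | instr _ => false
  | seq p q => setsRReg r p || setsRReg r q
  | ite _ p q => setsRReg r p || setsRReg r q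
  | loop _ p => setsRReg r p

/-- Some real array occurs as a target in the program. -/
def setsRMem : Program → Bool
  | instr (.rstore _ _ _) => true
  | instr _ => false
  | seq p q => setsRMem p || setsRMem q
  | ite _ p q => setsRMem p || setsRMem q
  | loop _ p => setsRMem p

end Program

/-- The states `s` and `s'` agree on everything that is not a target in `p`. -/
structure Frame (p : Program) (s s' : State) : Prop where
  reg : ∀ r, p.setsReg r = false → s'.reg r = s.reg r
  mem : ∀ A, p.setsMem A = false → s'.mem A = s.mem A
  rreg : ∀ r, p.setsRReg r = false → s'.rreg r = s.rreg r
  rmem : p.setsRMem = false → s'.rmem = s.rmem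

theorem Frame.refl (p : Program) (s : State) : Frame p s s :=
  ⟨fun _ _ => rfl, fun _ _ => rfl, fun _ _ => rfl, fun _ => rfl⟩

theorem Frame.trans' {p q r : Program} {s s₁ s₂ : State} (h₁ : Frame p s s₁) (h₂ : Frame q s₁ s₂)
    (hr : ∀ i, r.setsReg i = false → p.setsReg i = false ∧ q.setsReg i = false)
    (hm : ∀ i, r.setsMem i = false → p.setsMem i = false ∧ q.setsMem i = false)
    (hrr : ∀ i, r.setsRReg i = false → p.setsRReg i = false ∧ q.setsRReg i = false)
    (hrm : r.setsRMem = false → p.setsRMem = false ∧ q.setsRMem = false) : Frame r s s₂ where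
  reg i h := (h₂.reg i (hr i h).2).trans (h₁.reg i (hr i h).1)
  mem i h := (h₂.mem i (hm i h).2).trans (h₁.mem i (hm i h).1)
  rreg i h := (h₂.rreg i (hrr i h).2).trans (h₁.rreg i (hrr i h).1)
  rmem h := (h₂.rmem (hrm h).2).trans (h₁.rmem (hrm h).1)

theorem Frame.trans {p : Program} {s s₁ s₂ : State} (h₁ : Frame p s s₁) (h₂ : Frame p s₁ s₂) :
    Frame p s s₂ :=
  h₁.trans' h₂ (fun _ h => ⟨h, h⟩) (fun _ h => ⟨h, h⟩) (fun _ h => ⟨h, h⟩) (fun h => ⟨h, h⟩)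

/-- The write sets are syntactic, so for a concrete program the preservation of a register or array
reduces to a computation, checked by `rfl`. -/
theorem Exec.frame {w : ℕ} {p : Program} {s s' : State} {t : ℕ} (h : Exec w p s t s') :
    Frame p s s' := by
  induction h with
  | instr i s =>
    cases i <;> constructor <;> intros <;>
      simp_all [Instr.run, Program.setsReg, Program.setsMem, Program.setsRReg, Program.setsRMem]
  | seq _ _ ih₁ ih₂ =>
    exact ih₁.trans' ih₂ (fun _ h => by simpa [Program.setsReg] using h)
      (fun _ h => by simpa [Program.setsMem] using h)
      (fun _ h => by simpa [Program.setsRReg] using h)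
      (fun h => by simpa [Program.setsRMem] using h)
  | ite_true _ _ ih =>
    exact ih.trans' (Frame.refl (.instr .nop) _) (fun _ h => by simp_all [Program.setsReg])
      (fun _ h => by simp_all [Program.setsMem])
      (fun _ h => by simp_all [Program.setsRReg])
      (fun h => by simp_all [Program.setsRMem])
  | ite_false _ _ ih =>
    exact ih.trans' (Frame.refl (.instr .nop) _) (fun _ h => by simp_all [Program.setsReg])
      (fun _ h => by simp_all [Program.setsMem])
      (fun _ h => by simp_all [Program.setsRReg])
      (fun h => by simp_all [Program.setsRMem])
  | loop_true _ _ _ ih₁ ih₂ =>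
    exact ih₁.trans' ih₂ (fun _ h => ⟨h, h⟩) (fun _ h => ⟨h, h⟩) (fun _ h => ⟨h, h⟩)
      (fun h => ⟨h, h⟩)
  | loop_false _ => exact Frame.refl _ _

/-- The program `p`, started in the state `s`, halts within time `p.cost n` in a state that
satisfies `Post`. -/
def Runs (n w : ℕ) (p : Program) (s : State) (Post : State → Prop) : Prop :=
  ∃ t s', Exec w p s t s' ∧ t ≤ p.cost n ∧ Post s'

namespace Runs

variable {n w : ℕ} {p q : Program} {s : State} {Post Post' : State → Prop} {c : Cond}

theorem mono (h : Runs n w p s Post) (h' : ∀ s', Post s' → Frame p s s' → Post' s') :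
    Runs n w p s Post' := by
  obtain ⟨t, s', h1, h2, h3⟩ := h
  exact ⟨t, s', h1, h2, h' s' h3 h1.frame⟩

theorem seq (h : Runs n w p s fun s₁ => Runs n w q s₁ Post) : Runs n w (p.seq q) s Post := by
  obtain ⟨t, s', h1, h2, t', s'', h3, h4, h5⟩ := h
  exact ⟨t + t', s'', .seq h1 h3, by rw [Program.cost]; omega, h5⟩

theorem ite (h : c.holds s → Runs n w p s Post) (h' : ¬ c.holds s → Runs n w q s Post) :
    Runs n w (.ite c p q) s Post := by
  by_cases hc : c.holds s
  · obtain ⟨t, s', h1, h2, h3⟩ := h hc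
    exact ⟨t + 1, s', .ite_true hc h1, by rw [Program.cost]; omega, h3⟩
  · obtain ⟨t, s', h1, h2, h3⟩ := h' hc
    exact ⟨t + 1, s', .ite_false hc h1, by rw [Program.cost]; omega, h3⟩

/-- Here `m` is the exact number of rounds. The frame relative to the initial state is handed to
every round, so invariants need not mention what the loop leaves alone. -/
theorem loop (m : ℕ) (hm : m ≤ n) (I : ℕ → State → Prop) (h0 : I 0 s)
    (hstep : ∀ i < m, ∀ s', Frame (.loop c p) s s' → I i s' →
      c.holds s' ∧ Runs n w p s' (I (i + 1)))
    (hend : ∀ s', Frame (.loop c p) s s' → I m s' → ¬ c.holds s') :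
    Runs n w (.loop c p) s (I m) := by
  have key : ∀ d i s', i + d = m → Frame (.loop c p) s s' → I i s' →
      ∃ t s'', Exec w (.loop c p) s' t s'' ∧ t ≤ d * (p.cost n + 1) + 1 ∧ I m s'' := by
    intro d
    induction d with
    | zero =>
      intro i s' hi hf hI
      obtain rfl : i = m := by omega
      exact ⟨1, s', .loop_false (hend s' hf hI), by omega, hI⟩
    | succ d ih =>
      intro i s' hi hf hI
      obtain ⟨hc, t, s₁, h1, h2, h3⟩ := hstep i (by omega) s' hf hI
      have hf₁ : Frame (.loop c p) s' s₁ := ⟨h1.frame.reg, h1.frame.mem, h1.frame.rreg, h1.frame.rmem⟩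
      obtain ⟨t', s₂, h4, h5, h6⟩ := ih (i + 1) s₁ (by omega) (hf.trans hf₁) h3
      exact ⟨_, s₂, .loop_true hc h1 h4, by rw [Nat.succ_mul]; omega, h6⟩
  obtain ⟨t, s', h1, h2, h3⟩ := key m 0 s (by omega) (Frame.refl _ _) h0
  refine ⟨t, s', h1, ?_, h3⟩
  rw [Program.cost]
  have := Nat.mul_le_mul_right (p.cost n + 1) hm
  omega

theorem instr {i : Instr} (h : Post (i.run w s)) : Runs n w (.instr i) s Post :=
  ⟨1, _, .instr i s, le_rfl, h⟩

theorem nop (h : Post s) : Runs n w (.instr .nop) s Post := instr h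

theorem const {d v : ℕ} (hv : v < 2 ^ w) (h : Post (s.setReg d v)) :
    Runs n w (.instr (.const d v)) s Post :=
  instr (by rwa [Instr.run, Nat.mod_eq_of_lt hv])

theorem move {d a : ℕ} (h : Post (s.setReg d (s.reg a))) : Runs n w (.instr (.move d a)) s Post :=
  instr h

theorem add {d a b : ℕ} (hv : s.reg a + s.reg b < 2 ^ w)
    (h : Post (s.setReg d (s.reg a + s.reg b))) : Runs n w (.instr (.op .add d a b)) s Post :=
  instr (by rwa [Instr.run, WordOp.eval, Nat.mod_eq_of_lt hv])

theorem sub {d a b : ℕ} (hv : s.reg b ≤ s.reg a) (hv' : s.reg a < 2 ^ w)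
    (h : Post (s.setReg d (s.reg a - s.reg b))) : Runs n w (.instr (.op .sub d a b)) s Post := by
  refine instr ?_
  rw [Instr.run, WordOp.eval, Nat.mod_eq_of_lt (lt_of_le_of_lt hv hv')]
  have : s.reg a + (2 ^ w - s.reg b) = s.reg a - s.reg b + 2 ^ w := by omega
  rwa [this, Nat.add_mod_right, Nat.mod_eq_of_lt (by omega)]

theorem load {d A i : ℕ} (h : Post (s.setReg d (s.mem A (s.reg i)))) :
    Runs n w (.instr (.load d A i)) s Post := instr h

theorem store {A i a : ℕ} (h : Post (s.setMem A (s.reg i) (s.reg a))) :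
    Runs n w (.instr (.store A i a)) s Post := instr h

theorem rmove {d a : ℕ} (h : Post (s.setRReg d (s.rreg a))) :
    Runs n w (.instr (.rmove d a)) s Post := instr h

theorem rload {d A i : ℕ} (h : Post (s.setRReg d (s.rmem A (s.reg i)))) :
    Runs n w (.instr (.rload d A i)) s Post := instr h

end Runs

end RAM

namespace RAM

open NestedWindow

/-! ### The subroutines -/

infixr:60 " ;; " => Program.seq

/-- Add the contents of register `1` to register `r`. -/
def inc (r : ℕ) : Program := .instr (.op .add r r 1)

/-- Count in register `c` the indices at which real register `x` is less than real register `y`,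
where real register `4` runs through the real array `A`. -/
def countReals (A c x y : ℕ) : Program :=
  .instr (.const c 0) ;; .instr (.const 4 0) ;;
  .loop (.lt 4 0) (.instr (.rload 4 A 4) ;; .ite (.rlt x y) (inc c) (.instr .nop) ;; inc 4)

/-- Compute the position and the cuts of the L-shape whose index is in register `13`. -/
def locate : Program :=
  .instr (.rload 0 0 13) ;; .instr (.rload 1 2 13) ;;
  .ite (.rlt 0 1) (.instr (.rmove 2 0) ;; .instr (.rmove 3 1))
    (.instr (.rmove 2 1) ;; .instr (.rmove 3 0)) ;;
  countReals 0 9 4 0 ;; inc 9 ;; countReals 0 10 0 4 ;; inc 10 ;;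
  countReals 0 11 4 2 ;; countReals 0 12 3 4

/-- Write the indices of the L-shapes into the word array `3`, by decreasing height. -/
def sortHeights : Program :=
  .instr (.const 7 0) ;;
  .loop (.lt 7 0) (.instr (.rload 5 1 7) ;; countReals 1 8 5 4 ;; .instr (.store 3 8 7) ;; inc 7)

/-- Initialise the rows `0` of the word arrays `1` and `2`. -/
def initRows : Program :=
  .instr (.const 4 0) ;;
  .loop (.lt 4 0) (.instr (.op .sub 6 0 4) ;; .instr (.op .add 5 4 1) ;;
    .instr (.store 1 5 6) ;; .instr (.store 2 5 6) ;; inc 4)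

/-- Insert the position in register `16` into the row of the word array `X` at the address in
register `14`. The new row and its dual are written into `X` and `Y` at the address in
register `15`. -/
def insertRow (X Y : ℕ) : Program :=
  .instr (.const 17 0) ;; .instr (.move 4 0) ;;
  .loop (.lt 3 4) (
    .instr (.op .add 5 14 4) ;; .instr (.load 6 X 5) ;;
    .ite (.eq 4 16) (.instr (.const 18 0) ;; .instr (.move 17 6))
      (.ite (.lt 6 17) (.instr (.move 18 17) ;; .instr (.move 17 6)) (.instr (.move 18 6))) ;;
    .instr (.op .add 5 15 4) ;; .instr (.store X 5 18) ;;
    .instr (.op .add 5 15 18) ;; .instr (.store Y 5 4) ;; .instr (.op .sub 4 4 1))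

/-- Evaluate in register `8` the row of the word array `1` at the address in register `base` for
the window given by the registers `23` and `24`. -/
def countRow (base : ℕ) : Program :=
  .instr (.const 8 0) ;; .instr (.const 4 0) ;;
  .loop (.lt 4 0) (
    .instr (.op .add 5 4 1) ;; .instr (.op .add 5 base 5) ;; .instr (.load 6 1 5) ;;
    .instr (.op .add 5 4 24) ;;
    .ite (.lt 4 23) (.instr .nop) (.ite (.lt 5 0)
      (.ite (.lt 24 6) (.instr .nop) (inc 8)) (.instr .nop)) ;;
    inc 4)

variable {n w : ℕ} {s : State}

/-- Real register `4` holds the current array entry, so an operand `4` in the comparison means that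
entry, while any other operand is a fixed value. -/
theorem runs_countReals {A c x y : ℕ} (h0 : s.reg 0 = n) (h1 : s.reg 1 = 1) (hw : n < 2 ^ w)
    (hc : 4 < c) (P : ℕ → Prop) [DecidablePred P]
    (hP : ∀ j, (if x = 4 then s.rmem A j else s.rreg x) <
      (if y = 4 then s.rmem A j else s.rreg y) ↔ P j) :
    Runs n w (countReals A c x y) s fun s' => s'.reg c = Nat.count P n := by
  have hc0 : 0 ≠ c := by omega
  have hc1 : 1 ≠ c := by omega
  have hc4 : 4 ≠ c := by omega
  refine Runs.seq (Runs.const (by omega) (Runs.seq (Runs.const (by omega) ?_)))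
  refine (Runs.loop n le_rfl (fun i s' => s'.reg 4 = i ∧ s'.reg c = Nat.count P i) ?_ ?_ ?_).mono ?_
  · simp [hc4.symm]
  · rintro i hi s' hf ⟨h4, h8⟩
    have e0 : s'.reg 0 = n := by
      rw [hf.reg 0 (by simp [Program.setsReg, inc, hc0])]; simp [hc0, h0]
    have e1 : s'.reg 1 = 1 := by
      rw [hf.reg 1 (by simp [Program.setsReg, inc, hc1])]; simp [hc1, h1]
    have er : ∀ z, z ≠ 4 → s'.rreg z = s.rreg z := fun z hz => by
      rw [hf.rreg z (by simp [Program.setsRReg, inc, hz])]; simp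
    have em : s'.rmem = s.rmem := by
      rw [hf.rmem (by simp [Program.setsRMem, inc])]; simp
    have hle : Nat.count P i ≤ i := Nat.count_le _
    have hP' : (Cond.rlt x y).holds (s'.setRReg 4 (s'.rmem A (s'.reg 4))) ↔ P i := by
      rw [← hP i]
      simp only [Cond.holds, State.setRReg_rreg, em, h4]
      by_cases hx : x = 4 <;> by_cases hy : y = 4 <;> simp [hx, hy, er]
    refine ⟨by simp [Cond.holds, h4, e0, hi], ?_⟩
    refine Runs.seq (Runs.rload (Runs.seq (Runs.ite (fun h => Runs.add ?_ ?_) (fun h => Runs.nop ?_))))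
    · simp [h8, e1]; omega
    · rw [hP'] at h
      refine Runs.add ?_ ?_
      · simp [h4, e1, hc4, hc1]; omega
      · simp [h4, e1, hc4, hc1, hc4.symm, Nat.count_succ, h8, h]
    · rw [hP'] at h
      refine Runs.add ?_ ?_
      · simp [h4, e1]; omega
      · simp [h4, e1, hc4.symm, Nat.count_succ, h8, h]
  · rintro s' hf ⟨h4, -⟩
    have e0 : s'.reg 0 = n := by
      rw [hf.reg 0 (by simp [Program.setsReg, inc, hc0])]; simp [hc0, h0]
    simp [Cond.holds, h4, e0]
  · rintro s' ⟨-, h⟩ -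
    exact h

theorem runs_inc {r : ℕ} (h1 : s.reg 1 = 1) (hr : s.reg r + 1 < 2 ^ w) :
    Runs n w (inc r) s fun s' => s'.reg r = s.reg r + 1 :=
  Runs.add (by rwa [h1]) (by simp [h1])

theorem runs_locate (h0 : s.reg 0 = n) (h1 : s.reg 1 = 1) (hw : n + 1 < 2 ^ w) :
    Runs n w locate s fun s' =>
      s'.reg 9 = countBelow n (s.rmem 0) (s.rmem 0 (s.reg 13)) + 1 ∧
      s'.reg 10 = countAbove n (s.rmem 0) (s.rmem 0 (s.reg 13)) + 1 ∧
      s'.reg 11 = cutLeft n (s.rmem 0) (s.rmem 2) (s.reg 13) ∧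
      s'.reg 12 = cutRight n (s.rmem 0) (s.rmem 2) (s.reg 13) ∧
      s'.rreg 0 = s.rmem 0 (s.reg 13) ∧ s'.rreg 1 = s.rmem 2 (s.reg 13) := by
  have hbelow := countBelow_le n (s.rmem 0)
  have habove := countAbove_le n (s.rmem 0)
  refine Runs.seq (Runs.rload (Runs.seq (Runs.rload (Runs.seq ?_))))
  -- The part common to both branches, once the minimum and the maximum of foot and free end are in
  -- real registers `2` and `3`.
  have key : ∀ s' : State, s'.reg 0 = n → s'.reg 1 = 1 → s'.rmem 0 = s.rmem 0 →
      s'.rreg 0 = s.rmem 0 (s.reg 13) → s'.rreg 1 = s.rmem 2 (s.reg 13) →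
      s'.rreg 2 = min (s.rmem 0 (s.reg 13)) (s.rmem 2 (s.reg 13)) →
      s'.rreg 3 = max (s.rmem 0 (s.reg 13)) (s.rmem 2 (s.reg 13)) →
      Runs n w (countReals 0 9 4 0 ;; inc 9 ;; countReals 0 10 0 4 ;; inc 10 ;;
        countReals 0 11 4 2 ;; countReals 0 12 3 4) s' fun s' =>
      s'.reg 9 = countBelow n (s.rmem 0) (s.rmem 0 (s.reg 13)) + 1 ∧
      s'.reg 10 = countAbove n (s.rmem 0) (s.rmem 0 (s.reg 13)) + 1 ∧
      s'.reg 11 = cutLeft n (s.rmem 0) (s.rmem 2) (s.reg 13) ∧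
      s'.reg 12 = cutRight n (s.rmem 0) (s.rmem 2) (s.reg 13) ∧
      s'.rreg 0 = s.rmem 0 (s.reg 13) ∧ s'.rreg 1 = s.rmem 2 (s.reg 13) := by
    intro s0 g0 g1 gm gr0 gr1 gr2 gr3
    refine Runs.seq ((runs_countReals g0 g1 (by omega) (by norm_num)
      (fun j => s.rmem 0 j < s.rmem 0 (s.reg 13)) (by simp [gm, gr0])).mono ?_)
    intro s1 e1 f1
    refine Runs.seq ((runs_inc (by rw [f1.reg 1 rfl, g1]) ?_).mono ?_)
    · rw [e1]
      have := hbelow (s.rmem 0 (s.reg 13))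
      unfold countBelow at this
      omega
    intro s2 e2 f2
    refine Runs.seq ((runs_countReals (by rw [f2.reg 0 rfl, f1.reg 0 rfl, g0])
      (by rw [f2.reg 1 rfl, f1.reg 1 rfl, g1]) (by omega) (by norm_num)
      (fun j => s.rmem 0 (s.reg 13) < s.rmem 0 j)
      (by simp [f2.rmem rfl, f1.rmem rfl, f2.rreg 0 rfl, f1.rreg 0 rfl, gm, gr0])).mono ?_)
    intro s3 e3 f3
    refine Runs.seq ((runs_inc (by rw [f3.reg 1 rfl, f2.reg 1 rfl, f1.reg 1 rfl, g1]) ?_).mono ?_)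
    · rw [e3]
      have := habove (s.rmem 0 (s.reg 13))
      unfold countAbove at this
      omega
    intro s4 e4 f4
    refine Runs.seq ((runs_countReals
      (by rw [f4.reg 0 rfl, f3.reg 0 rfl, f2.reg 0 rfl, f1.reg 0 rfl, g0])
      (by rw [f4.reg 1 rfl, f3.reg 1 rfl, f2.reg 1 rfl, f1.reg 1 rfl, g1]) (by omega) (by norm_num)
      (fun j => s.rmem 0 j < min (s.rmem 0 (s.reg 13)) (s.rmem 2 (s.reg 13)))
      (by simp [f4.rmem rfl, f3.rmem rfl, f2.rmem rfl, f1.rmem rfl, f4.rreg 2 rfl, f3.rreg 2 rfl,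
        f2.rreg 2 rfl, f1.rreg 2 rfl, gm, gr2])).mono ?_)
    intro s5 e5 f5
    refine (runs_countReals
      (by rw [f5.reg 0 rfl, f4.reg 0 rfl, f3.reg 0 rfl, f2.reg 0 rfl, f1.reg 0 rfl, g0])
      (by rw [f5.reg 1 rfl, f4.reg 1 rfl, f3.reg 1 rfl, f2.reg 1 rfl, f1.reg 1 rfl, g1])
      (by omega) (by norm_num)
      (fun j => max (s.rmem 0 (s.reg 13)) (s.rmem 2 (s.reg 13)) < s.rmem 0 j)
      (by simp [f5.rmem rfl, f4.rmem rfl, f3.rmem rfl, f2.rmem rfl, f1.rmem rfl, f5.rreg 3 rfl,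
        f4.rreg 3 rfl, f3.rreg 3 rfl, f2.rreg 3 rfl, f1.rreg 3 rfl, gm, gr3])).mono ?_
    intro s6 e6 f6
    refine ⟨?_, ?_, ?_, e6, ?_, ?_⟩
    · rw [f6.reg 9 rfl, f5.reg 9 rfl, f4.reg 9 rfl, f3.reg 9 rfl, e2, e1]; rfl
    · rw [f6.reg 10 rfl, f5.reg 10 rfl, e4, e3]; rfl
    · rw [f6.reg 11 rfl, e5]; rfl
    · rw [f6.rreg 0 rfl, f5.rreg 0 rfl, f4.rreg 0 rfl, f3.rreg 0 rfl, f2.rreg 0 rfl,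
        f1.rreg 0 rfl, gr0]
    · rw [f6.rreg 1 rfl, f5.rreg 1 rfl, f4.rreg 1 rfl, f3.rreg 1 rfl, f2.rreg 1 rfl,
        f1.rreg 1 rfl, gr1]
  refine Runs.ite (fun h => Runs.seq (Runs.rmove (Runs.rmove ?_)))
    (fun h => Runs.seq (Runs.rmove (Runs.rmove ?_)))
  · simp only [Cond.holds, State.setRReg_rreg, State.setRReg_reg, State.setRReg_rmem] at h
    norm_num at h
    apply key <;> simp [h0, h1, h.le]
  · simp only [Cond.holds, State.setRReg_rreg, State.setRReg_reg, State.setRReg_rmem] at h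
    norm_num at h
    apply key <;> simp [h0, h1, h]

/-- Each index is written at its rank; distinct heights have distinct ranks, so no entry is
overwritten. -/
theorem runs_sortHeights (h0 : s.reg 0 = n) (h1 : s.reg 1 = 1) (hw : n + 1 < 2 ^ w)
    (hH : ∀ i j, i < n → j < n → s.rmem 1 i = s.rmem 1 j → i = j) :
    Runs n w sortHeights s fun s' => Sorts n (s.rmem 1) (s'.mem 3) := by
  refine Runs.seq (Runs.const (by omega) ?_)
  refine (Runs.loop n le_rfl (fun i s' => s'.reg 7 = i ∧
    ∀ j < i, s'.mem 3 (countAbove n (s.rmem 1) (s.rmem 1 j)) = j) ?_ ?_ ?_).mono ?_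
  · simp
  · rintro i hi s0 f0 ⟨h7, hj⟩
    have e0 : s0.reg 0 = n := by rw [f0.reg 0 rfl]; simp [h0]
    have e1 : s0.reg 1 = 1 := by rw [f0.reg 1 rfl]; simp [h1]
    have em : s0.rmem = s.rmem := by rw [f0.rmem rfl]; simp
    refine ⟨by simp [Cond.holds, h7, e0, hi], ?_⟩
    refine Runs.seq (Runs.rload (Runs.seq ((runs_countReals (by simp [e0]) (by simp [e1])
      (by omega) (by norm_num) (fun j => s.rmem 1 i < s.rmem 1 j) (by simp [em, h7])).mono ?_)))
    intro s1 g8 f1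
    have g7 : s1.reg 7 = i := by rw [f1.reg 7 rfl]; simp [h7]
    have g1 : s1.reg 1 = 1 := by rw [f1.reg 1 rfl]; simp [e1]
    have gm : s1.mem 3 = s0.mem 3 := by rw [f1.mem 3 rfl]; simp
    refine Runs.seq (Runs.store (Runs.add ?_ ?_))
    · simp [g7, g1]; omega
    · refine ⟨by simp [g7, g1], fun j hji => ?_⟩
      simp only [State.setReg_mem, State.setMem_mem, true_and, g7, g8, gm]
      split_ifs with h
      · have h' : countAbove n (s.rmem 1) (s.rmem 1 j) = countAbove n (s.rmem 1) (s.rmem 1 i) := h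
        apply hH i j hi (by omega)
        exact le_antisymm ((countAbove_le_iff hi).1 h'.le)
          ((countAbove_le_iff (by omega)).1 h'.ge)
      · rcases Nat.lt_succ_iff_lt_or_eq.1 hji with hji | rfl
        · exact hj j hji
        · exact absurd rfl h
  · rintro s' f ⟨h7, -⟩
    have e0 : s'.reg 0 = n := by rw [f.reg 0 rfl]; simp [h0]
    simp [Cond.holds, h7, e0]
  · rintro s' ⟨-, h⟩ -
    exact Sorts.of_rank hH h

theorem runs_initRows (h0 : s.reg 0 = n) (h1 : s.reg 1 = 1) (hw : n + 1 < 2 ^ w)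
    (hX : ∀ j, s.mem 1 j = 0 ∧ s.mem 2 j = 0) :
    Runs n w initRows s fun s' =>
      (∀ k, 1 ≤ k → k ≤ n → s'.mem 1 k = n + 1 - k ∧ s'.mem 2 k = n + 1 - k) ∧
      ∀ k, n < k → s'.mem 1 k = 0 ∧ s'.mem 2 k = 0 := by
  refine Runs.seq (Runs.const (by omega) ?_)
  refine (Runs.loop n le_rfl (fun i s' => s'.reg 4 = i ∧
    (∀ k, 1 ≤ k → k ≤ i → s'.mem 1 k = n + 1 - k ∧ s'.mem 2 k = n + 1 - k) ∧
    ∀ k, n < k → s'.mem 1 k = 0 ∧ s'.mem 2 k = 0) ?_ ?_ ?_).mono ?_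
  · refine ⟨by simp, fun k h h' => by omega, fun k _ => hX k⟩
  · rintro i hi s0 f0 ⟨h4, hk, hk'⟩
    have e0 : s0.reg 0 = n := by rw [f0.reg 0 rfl]; simp [h0]
    have e1 : s0.reg 1 = 1 := by rw [f0.reg 1 rfl]; simp [h1]
    refine ⟨by simp [Cond.holds, h4, e0, hi], ?_⟩
    refine Runs.seq (Runs.sub ?_ ?_ (Runs.seq (Runs.add ?_ (Runs.seq (Runs.store
      (Runs.seq (Runs.store (Runs.add ?_ ?_))))))))
    · simp [h4, e0]; omega
    · simp [e0]; omega
    · simp [h4, e1]; omega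
    · simp [h4, e1]; omega
    · refine ⟨by simp [h4, e1], fun k h h' => ?_, fun k h => ?_⟩
      · by_cases hki : k = i + 1
        · simp [h4, e1, e0, hki]
        · simpa [h4, e1, e0, hki] using hk k h (by omega)
      · have hki : k ≠ i + 1 := by omega
        simpa [h4, e1, e0, hki] using hk' k h
  · rintro s' f ⟨h4, -⟩
    have e0 : s'.reg 0 = n := by rw [f.reg 0 rfl]; simp [h0]
    simp [Cond.holds, h4, e0]
  · rintro s' ⟨-, h⟩ -
    exact h

end RAM

/-! ### Correctness of row insertion and row evaluation. -/

namespace RAM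

open NestedWindow

variable {n w : ℕ} {s : State}

theorem ins_le_size {n : ℕ} {A : ℕ → ℕ} {p : ℕ} (hp : p ≤ n)
    (hA : ∀ k, 1 ≤ k → k ≤ n → A k + k ≤ n + 1) {k : ℕ} (h1 : 1 ≤ k) (h2 : k ≤ n) :
    ins A p k ≤ n := by
  have := ins_le hp hA h1 h2
  omega

/-- To the right of `p` both runs are empty with default `0`, so the scan may start with `0` and
needs a special case only at `p`. -/
theorem runMin_pred_of_ne {A : ℕ → ℕ} {p l : ℕ} (h : l + 1 ≠ p) :
    runMin A p l = min (runMin A p (l + 1)) (A (l + 1)) := by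
  rcases lt_or_gt_of_ne h with h | h
  · exact runMin_pred h
  · rw [runMin_of_le (by omega), runMin_of_le (by omega), zero_min]

/-- The state of `insertRow` when the positions in `(l, n]` have been processed. -/
structure InsertInv (n X Y base : ℕ) (A : ℕ → ℕ) (p : ℕ) (s : State) (l : ℕ) (s' : State) :
    Prop where
  pos : s'.reg 4 = l
  cur : s'.reg 17 = runMin A p l
  old : ∀ j < base + (n + 1), s'.mem X j = s.mem X j ∧ s'.mem Y j = s.mem Y j
  row : ∀ k, l < k → k ≤ n → s'.mem X (base + (n + 1) + k) = ins A p k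
  dual : ∀ m, 1 ≤ m → m ≤ n → s'.mem Y (base + (n + 1) + m) = firstPos n (ins A p) l m
  fresh : ∀ j, base + (n + 1) + (n + 1) ≤ j → s'.mem X j = 0 ∧ s'.mem Y j = 0

/-- A single pass from right to left computes both rows: the running minimum sits in register `17`,
the new threshold in register `18`, and `firstPos_pred` justifies the overwriting in `Y`. A
threshold `0` is written to slot `0` of the new row, which no clause of the invariant reads. -/
theorem runs_insertRow {X Y base : ℕ} {A : ℕ → ℕ} (hXY : X ≠ Y) (h0 : s.reg 0 = n)
    (h1 : s.reg 1 = 1) (h3 : s.reg 3 = 0) (h14 : s.reg 14 = base) (h15 : s.reg 15 = base + (n + 1))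
    (hw : base + (n + 1) + (n + 1) < 2 ^ w) (hp : 1 ≤ s.reg 16) (hp' : s.reg 16 ≤ n)
    (hA : ∀ k, 1 ≤ k → k ≤ n → A k + k ≤ n + 1)
    (hX : ∀ k, 1 ≤ k → k ≤ n → s.mem X (base + k) = A k)
    (hfresh : ∀ j, base + (n + 1) ≤ j → s.mem X j = 0 ∧ s.mem Y j = 0) :
    Runs n w (insertRow X Y) s (InsertInv n X Y base A (s.reg 16) s 0) := by
  set p := s.reg 16 with hpdef
  refine Runs.seq (Runs.const (by omega) (Runs.seq (Runs.move ?_)))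
  refine (Runs.loop n le_rfl (fun i => InsertInv n X Y base A p s (n - i)) ?_ ?_ ?_).mono ?_
  · refine ⟨by simp [h0], ?_, by simp, fun k h h' => by omega, fun m h h' => ?_, fun j h => ?_⟩
    · simp [runMin_of_le hp']
    · simp [firstPos_self, (hfresh (base + (n + 1) + m) (by omega)).2]
    · simpa using hfresh j (by omega)
  · intro i hi s0 f0 hinv
    obtain ⟨l, hl⟩ : ∃ l, n - i = l + 1 := ⟨n - i - 1, by omega⟩
    rw [hl] at hinv
    rw [show n - (i + 1) = l by omega]
    have e0 : s0.reg 0 = n := by rw [f0.reg 0 rfl]; simp [h0]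
    have e1 : s0.reg 1 = 1 := by rw [f0.reg 1 rfl]; simp [h1]
    have e3 : s0.reg 3 = 0 := by rw [f0.reg 3 rfl]; simp [h3]
    have e14 : s0.reg 14 = base := by rw [f0.reg 14 rfl]; simp [h14]
    have e15 : s0.reg 15 = base + (n + 1) := by rw [f0.reg 15 rfl]; simp [h15]
    have e16 : s0.reg 16 = p := by rw [f0.reg 16 rfl]; simp [hpdef]
    have e4 := hinv.pos
    have e17 := hinv.cur
    have eA : s0.mem X (base + (l + 1)) = A (l + 1) := by
      rw [(hinv.old _ (by omega)).1]; exact hX _ (by omega) (by omega)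
    have hy := ins_le_size hp' hA (k := l + 1) (by omega) (by omega)
    refine ⟨by simp [Cond.holds, e3, e4], ?_⟩
    refine Runs.seq (Runs.add (by rw [e14, e4]; omega) (Runs.seq (Runs.load (Runs.seq ?_))))
    -- The two writes common to the three cases: at `p`, threshold below the carried minimum,
    -- threshold not below it.
    have key : ∀ s1 : State, s1.reg 1 = 1 → s1.reg 4 = l + 1 → s1.reg 15 = base + (n + 1) →
        s1.mem = s0.mem → s1.reg 17 = runMin A p l → s1.reg 18 = ins A p (l + 1) →
        Runs n w (.instr (.op .add 5 15 4) ;; .instr (.store X 5 18) ;;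
          .instr (.op .add 5 15 18) ;; .instr (.store Y 5 4) ;; .instr (.op .sub 4 4 1)) s1
          (InsertInv n X Y base A p s l) := by
      intro s1 g1 g4 g15 gm g17 g18
      refine Runs.seq (Runs.add (by rw [g15, g4]; omega) (Runs.seq (Runs.store (Runs.seq
        (Runs.add ?_ (Runs.seq (Runs.store (Runs.sub ?_ ?_ ?_))))))))
      · simp [g15, g18]; omega
      · simp [g1, g4]
      · simp [g4]; omega
      · have hmX : ∀ j, ((((((s1.setReg 5 (s1.reg 15 + s1.reg 4)).setMem X
            (base + (n + 1) + (l + 1)) (ins A p (l + 1))).setReg 5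
            (base + (n + 1) + ins A p (l + 1))).setMem Y (base + (n + 1) + ins A p (l + 1))
            (l + 1))).setReg 4 l).mem X j =
            if j = base + (n + 1) + (l + 1) then ins A p (l + 1) else s0.mem X j := by
          intro j; simp [hXY, gm]
        have hmY : ∀ j, ((((((s1.setReg 5 (s1.reg 15 + s1.reg 4)).setMem X
            (base + (n + 1) + (l + 1)) (ins A p (l + 1))).setReg 5
            (base + (n + 1) + ins A p (l + 1))).setMem Y (base + (n + 1) + ins A p (l + 1))
            (l + 1))).setReg 4 l).mem Y j =
            if j = base + (n + 1) + ins A p (l + 1) then l + 1 else s0.mem Y j := by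
          intro j; simp [hXY.symm, gm]
        simp only [State.setReg_reg, State.setMem_reg, g1, g4, g15, g18]
        norm_num
        simp only [g4, g15] at hmX hmY
        refine ⟨by simp, by simp [g17], fun j hj => ?_, fun k h h' => ?_, fun m h h' => ?_,
          fun j h => ?_⟩
        · rw [hmX, hmY, if_neg (by omega), if_neg (by omega)]
          exact hinv.old j hj
        · rw [hmX]
          split_ifs with hk
          · rw [show k = l + 1 by omega]
          · exact hinv.row k (by omega) h'
        · rw [hmY, firstPos_pred (by omega), hinv.dual m h h']
          congr 1
          simp only [eq_iff_iff]
          omega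
        · rw [hmX, hmY, if_neg (by omega), if_neg (by omega)]
          exact hinv.fresh j h
    have gx : (s0.setReg 5 (s0.reg 14 + s0.reg 4)).mem X
        ((s0.setReg 5 (s0.reg 14 + s0.reg 4)).reg 5) = A (l + 1) := by simp [e14, e4, eA]
    rw [gx]
    refine Runs.ite (fun h => Runs.seq (Runs.const (by omega) (Runs.move ?_)))
      (fun h => Runs.ite (fun h' => Runs.seq (Runs.move (Runs.move ?_))) (fun h' => Runs.move ?_))
    · simp [Cond.holds, e4, e16] at h
      refine key _ ?_ ?_ ?_ ?_ ?_ ?_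
      · simp [e1]
      · simp [e4]
      · simp [e15]
      · simp
      · simp only [State.setReg_reg]; norm_num; rw [← h, runMin_self]
      · simp only [State.setReg_reg]; norm_num; rw [h, ins_self]
    · simp [Cond.holds, e4, e16] at h
      simp [Cond.holds, e17] at h'
      refine key _ ?_ ?_ ?_ ?_ ?_ ?_
      · simp [e1]
      · simp [e4]
      · simp [e15]
      · simp
      · simp only [State.setReg_reg]; norm_num
        rw [runMin_pred_of_ne h, min_eq_right h'.le]
      · simp only [State.setReg_reg]; norm_num
        rw [ins, if_neg h, max_eq_right h'.le, e17]
    · simp [Cond.holds, e4, e16] at h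
      simp [Cond.holds, e17] at h'
      refine key _ ?_ ?_ ?_ ?_ ?_ ?_
      · simp [e1]
      · simp [e4]
      · simp [e15]
      · simp
      · simp only [State.setReg_reg]; norm_num
        rw [runMin_pred_of_ne h, min_eq_left h', e17]
      · simp only [State.setReg_reg]; norm_num
        rw [ins, if_neg h, max_eq_left h']
  · intro s' f hinv
    have e3 : s'.reg 3 = 0 := by rw [f.reg 3 rfl]; simp [h3]
    have := hinv.pos
    simp [Cond.holds, e3, this]
  · intro s' hinv _
    simpa using hinv

theorem runs_countRow {base b₀ : ℕ} {A : ℕ → ℕ} (hb : 8 < base) (h0 : s.reg 0 = n)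
    (h1 : s.reg 1 = 1) (hbase : s.reg base = b₀) (hw : b₀ + (n + 1) < 2 ^ w)
    (hw' : n + n < 2 ^ w) (h24 : s.reg 24 ≤ n)
    (hA : ∀ k, 1 ≤ k → k ≤ n → s.mem 1 (b₀ + k) = A k) :
    Runs n w (countRow base) s fun s' => s'.reg 8 = cnt n A (s.reg 23) (s.reg 24) := by
  set P : ℕ → Prop := fun i => s.reg 23 ≤ i ∧ i + s.reg 24 < n ∧ A (i + 1) ≤ s.reg 24 with hP
  have hb8 : base ≠ 8 := by omega
  have hb4 : base ≠ 4 := by omega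
  have hb5 : base ≠ 5 := by omega
  have hb6 : base ≠ 6 := by omega
  refine Runs.seq (Runs.const (by omega) (Runs.seq (Runs.const (by omega) ?_)))
  refine (Runs.loop n le_rfl (fun i s' => s'.reg 4 = i ∧ s'.reg 8 = Nat.count P i) ?_ ?_ ?_).mono ?_
  · simp
  · rintro i hi s0 f0 ⟨h4, h8⟩
    have e0 : s0.reg 0 = n := by rw [f0.reg 0 rfl]; simp [h0]
    have e1 : s0.reg 1 = 1 := by rw [f0.reg 1 rfl]; simp [h1]
    have eb : s0.reg base = b₀ := by
      rw [f0.reg base (by simp [Program.setsReg, inc, hb4, hb5, hb6, hb8])]; simp [hb4, hb8, hbase]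
    have e23 : s0.reg 23 = s.reg 23 := by rw [f0.reg 23 rfl]; simp
    have e24 : s0.reg 24 = s.reg 24 := by rw [f0.reg 24 rfl]; simp
    have em : s0.mem 1 = s.mem 1 := by rw [f0.mem 1 rfl]; simp
    have eA : s0.mem 1 (b₀ + (i + 1)) = A (i + 1) := by
      rw [em]; exact hA _ (by omega) (by omega)
    have hle : Nat.count P i ≤ i := Nat.count_le _
    refine ⟨by simp [Cond.holds, h4, e0, hi], ?_⟩
    refine Runs.seq (Runs.add ?_ (Runs.seq (Runs.add ?_ (Runs.seq (Runs.load (Runs.seq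
      (Runs.add ?_ (Runs.seq ?_))))))))
    · rw [h4, e1]; omega
    · simp [h4, e1, eb, hb5]; omega
    · simp [h4, e24]; omega
    · have fin : ∀ s1 : State, s1.reg 1 = 1 → s1.reg 4 = i → s1.reg 8 = Nat.count P (i + 1) →
          Runs n w (inc 4) s1 fun s' => s'.reg 4 = i + 1 ∧ s'.reg 8 = Nat.count P (i + 1) := by
        intro s1 g1 g4 g8
        refine Runs.add (by rw [g1, g4]; omega) ?_
        simp [g1, g4, g8]
      refine Runs.ite (fun h => Runs.nop ?_) (fun h => Runs.ite (fun h' => Runs.ite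
        (fun h'' => Runs.nop ?_) (fun h'' => Runs.add ?_ ?_)) (fun h' => Runs.nop ?_))
      · simp [Cond.holds, h4, e23] at h
        refine fin _ (by simp [e1]) (by simp [h4]) ?_
        have : ¬ P i := fun hPi => absurd hPi.1 (not_le.2 h)
        simp [Nat.count_succ, this, h8]
      · simp [Cond.holds, h4, e24, e1, eb, hb5, eA] at h''
        refine fin _ (by simp [e1]) (by simp [h4]) ?_
        have : ¬ P i := fun hPi => absurd hPi.2.2 (not_le.2 h'')
        simp [Nat.count_succ, this, h8]
      · simp [h8, e1]; omega
      · simp [Cond.holds, h4, e23] at h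
        simp [Cond.holds, h4, e24, e0] at h'
        simp [Cond.holds, h4, e24, e1, eb, hb5, eA] at h''
        refine fin _ (by simp [e1]) (by simp [h4]) ?_
        have : P i := ⟨h, h', h''⟩
        simp [Nat.count_succ, this, h8, e1]
      · simp [Cond.holds, h4, e24, e0] at h'
        refine fin _ (by simp [e1]) (by simp [h4]) ?_
        have : ¬ P i := fun hPi => absurd hPi.2.1 (not_lt.2 h')
        simp [Nat.count_succ, this, h8]
  · rintro s' f ⟨h4, -⟩
    have e0 : s'.reg 0 = n := by rw [f.reg 0 rfl]; simp [h0]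
    simp [Cond.holds, h4, e0]
  · rintro s' ⟨-, h⟩ -
    exact h

end RAM

/-! ### The algorithm and its forward stages. -/

namespace RAM

open NestedWindow

/-- Insert the `t`-th L-shape, where `t` is in register `7`, and update the best clique size in
register `19` and its description in the registers `20`, `21`, `22` and `27`. -/
def stage : Program :=
  .instr (.load 13 3 7) ;; locate ;; .instr (.op .add 15 14 2) ;;
  .ite (.rlt 0 1) (.instr (.move 16 9) ;; insertRow 1 2) (.instr (.move 16 10) ;; insertRow 2 1) ;;
  .instr (.move 23 11) ;; .instr (.move 24 12) ;; countRow 15 ;;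
  .ite (.lt 19 8)
    (.instr (.move 19 8) ;; .instr (.move 20 11) ;; .instr (.move 21 12) ;;
      .instr (.op .add 22 7 1) ;; .instr (.move 27 15)) (.instr .nop) ;;
  .instr (.move 14 15) ;; inc 7

/-- Insert all L-shapes. -/
def stages : Program := .instr (.const 7 0) ;; .loop (.lt 7 0) stage

/-- Decide whether the L-shape before the `t`-th one, where `t` is in register `7`, belongs to
the clique, write it to the word array `0` if so, and shrink the window. -/
def backStep : Program :=
  .instr (.op .sub 14 15 2) ;; countRow 15 ;; .instr (.move 26 8) ;; countRow 14 ;;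
  .instr (.op .sub 7 7 1) ;;
  .ite (.eq 26 8) (.instr .nop)
    (.instr (.load 13 3 7) ;; .instr (.store 0 25 13) ;; inc 25 ;; locate ;;
      .ite (.rlt 0 1) (.instr (.move 23 9)) (.instr (.move 24 10))) ;;
  .instr (.move 15 14)

/-- Write the best clique to the word array `0`. -/
def backtrack : Program :=
  .instr (.move 7 22) ;; .instr (.move 23 20) ;; .instr (.move 24 21) ;; .instr (.move 15 27) ;;
  .instr (.const 25 0) ;; .loop (.lt 3 7) backStep

/-- Find a maximum clique. -/
def maxClique : Program :=
  .instr (.const 1 1) ;; .instr (.op .add 2 0 1) ;; sortHeights ;; initRows ;; stages ;;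
  backtrack ;; .instr (.move 0 25)

variable {n w : ℕ} {F E : ℕ → ℝ} {o : ℕ → ℕ}

/-- The arrays after the insertion of the first `t` L-shapes in the order `o`. -/
noncomputable def arrays (n : ℕ) (F E : ℕ → ℝ) (o : ℕ → ℕ) (t : ℕ) : (ℕ → ℕ) × (ℕ → ℕ) :=
  rows n (posLeft n F o) (posRight n F o) (TurnsRight F E o) t

/-- The rows of the word arrays `1` and `2` after the insertion of the first `t` L-shapes. -/
structure Stored (n : ℕ) (F E : ℕ → ℝ) (o : ℕ → ℕ) (t : ℕ) (s : State) : Prop where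
  base : s.reg 14 = t * (n + 1)
  left : ∀ u ≤ t, ∀ k, 1 ≤ k → k ≤ n → s.mem 1 (u * (n + 1) + k) = (arrays n F E o u).1 k
  right : ∀ k, 1 ≤ k → k ≤ n → s.mem 2 (t * (n + 1) + k) = (arrays n F E o t).2 k
  fresh : ∀ j, t * (n + 1) + (n + 1) ≤ j → s.mem 1 j = 0 ∧ s.mem 2 j = 0

/-- The registers describe a best clique among those found in the first `t` stages. -/
structure BestSoFar (n : ℕ) (F E : ℕ → ℝ) (o : ℕ → ℕ) (t : ℕ) (s : State) : Prop where
  le : ∀ u < t, cliqueSize n F E o u ≤ s.reg 19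
  eq : (s.reg 19 = 0 ∧ s.reg 22 = 0) ∨ ∃ u < t, s.reg 19 = cliqueSize n F E o u ∧
    s.reg 20 = cutLeft n F E (o u) ∧ s.reg 21 = cutRight n F E (o u) ∧ s.reg 22 = u + 1 ∧
    s.reg 27 = (u + 1) * (n + 1)

/-- The registers that all stages use. -/
structure Consts (n : ℕ) (F E : ℕ → ℝ) (o : ℕ → ℕ) (s : State) : Prop where
  r0 : s.reg 0 = n
  r1 : s.reg 1 = 1
  r2 : s.reg 2 = n + 1
  r3 : s.reg 3 = 0
  foot : s.rmem 0 = F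
  free : s.rmem 2 = E
  order : s.mem 3 = o

theorem Consts.frame {p : Program} {s s' : State} (h : Consts n F E o s) (f : Frame p s s')
    (h0 : p.setsReg 0 = false) (h1 : p.setsReg 1 = false) (h2 : p.setsReg 2 = false)
    (h3 : p.setsReg 3 = false) (hm : p.setsMem 3 = false) (hr : p.setsRMem = false) :
    Consts n F E o s' :=
  ⟨by rw [f.reg 0 h0, h.r0], by rw [f.reg 1 h1, h.r1], by rw [f.reg 2 h2, h.r2],
    by rw [f.reg 3 h3, h.r3], by rw [f.rmem hr, h.foot], by rw [f.rmem hr, h.free],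
    by rw [f.mem 3 hm, h.order]⟩

theorem Consts.setReg {s : State} (h : Consts n F E o s) {d v : ℕ} (hd : 3 < d) :
    Consts n F E o (s.setReg d v) := by
  have h0 : 0 ≠ d := by omega
  have h1 : 1 ≠ d := by omega
  have h2 : 2 ≠ d := by omega
  have h3 : 3 ≠ d := by omega
  exact ⟨by simp [h0, h.r0], by simp [h1, h.r1], by simp [h2, h.r2], by simp [h3, h.r3],
    h.foot, h.free, h.order⟩

/-- The word size suffices for the addresses. -/
def Fits (n w : ℕ) : Prop := (n + 1) * (n + 1) + 2 * (n + 1) < 2 ^ w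

theorem Fits.address (h : Fits n w) {t : ℕ} (ht : t < n) :
    t * (n + 1) + (n + 1) + (n + 1) < 2 ^ w := by
  have : t * (n + 1) ≤ n * (n + 1) := Nat.mul_le_mul_right _ ht.le
  have h' : (n + 1) * (n + 1) + 2 * (n + 1) < 2 ^ w := h
  rw [Nat.succ_mul] at h'
  omega

theorem Fits.small (h : Fits n w) : 2 * (n + 1) < 2 ^ w := lt_of_le_of_lt (Nat.le_add_left _ _) h

/-- Turning left mirrors turning right: the two arrays and the two positions exchange roles. All
rows of array `1` are preserved for the backtracking; of array `2` only the newest row is asserted.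
-/
theorem runs_insertStage {s : State} (hn : Fits n w) (hl : Layout n (posLeft n F o) (posRight n F o))
    {t : ℕ} (ht : t < n) (hc : Consts n F E o s) (hs : Stored n F E o t s)
    (h9 : s.reg 9 = posLeft n F o t) (h10 : s.reg 10 = posRight n F o t)
    (h15 : s.reg 15 = t * (n + 1) + (n + 1))
    (hd : (Cond.rlt 0 1).holds s ↔ TurnsRight F E o t) :
    Runs n w (.ite (.rlt 0 1) (.instr (.move 16 9) ;; insertRow 1 2)
      (.instr (.move 16 10) ;; insertRow 2 1)) s fun s' =>
        (∀ u ≤ t + 1, ∀ k, 1 ≤ k → k ≤ n → s'.mem 1 (u * (n + 1) + k) = (arrays n F E o u).1 k) ∧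
        (∀ k, 1 ≤ k → k ≤ n → s'.mem 2 ((t + 1) * (n + 1) + k) = (arrays n F E o (t + 1)).2 k) ∧
        ∀ j, (t + 1) * (n + 1) + (n + 1) ≤ j → s'.mem 1 j = 0 ∧ s'.mem 2 j = 0 := by
  have hdual := (dual_rows (D := TurnsRight F E o) hl t ht.le).1
  have hadd := hl.add t ht
  have hpl := hl.left_pos t ht
  have hpr := hl.right_pos t ht
  have haddr : ∀ u ≤ t, ∀ k ≤ n, u * (n + 1) + k < t * (n + 1) + (n + 1) := fun u hu k hk => by
    have := Nat.mul_le_mul_right (n + 1) hu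
    omega
  rw [Nat.succ_mul]
  refine Runs.ite (fun h => Runs.seq (Runs.move ?_)) (fun h => Runs.seq (Runs.move ?_))
  · have hD := hd.1 h
    refine (runs_insertRow (A := (arrays n F E o t).1) (base := t * (n + 1)) (by norm_num) (by simp [hc.r0])
      (by simp [hc.r1]) (by simp [hc.r3]) (by simp [hs.base]) (by simp [h15]) (hn.address ht)
      (by simp [h9, hpl]) (by simp [h9]; omega) hdual.left_le (fun k h h' => by
        simpa using hs.left t le_rfl k h h') (by simpa using hs.fresh)).mono ?_
    intro s' hi _
    simp only [State.setReg_reg, if_true, h9] at hi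
    refine ⟨fun u hu k hk hk' => ?_, fun k hk hk' => ?_, hi.fresh⟩
    · rcases Nat.le_succ_iff.1 hu with hu | rfl
      · rw [(hi.old _ (haddr u hu k hk')).1]
        exact hs.left u hu k hk hk'
      · rw [Nat.succ_mul, hi.row k hk hk']
        simp only [arrays, rows, if_pos hD]
    · rw [hi.dual k hk hk']
      simp only [arrays, rows, if_pos hD]
  · have hD := fun h' => h (hd.2 h')
    refine (runs_insertRow (A := (arrays n F E o t).2) (base := t * (n + 1)) (by norm_num) (by simp [hc.r0])
      (by simp [hc.r1]) (by simp [hc.r3]) (by simp [hs.base]) (by simp [h15]) (hn.address ht)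
      (by simp [h10, hpr]) (by simp [h10]; omega) hdual.right_le (fun k h h' => by
        simpa using hs.right k h h') (fun j hj => by simpa using (hs.fresh j hj).symm)).mono ?_
    intro s' hi _
    simp only [State.setReg_reg, if_true, h10] at hi
    refine ⟨fun u hu k hk hk' => ?_, fun k hk hk' => ?_, fun j hj => (hi.fresh j hj).symm⟩
    · rcases Nat.le_succ_iff.1 hu with hu | rfl
      · rw [(hi.old _ (haddr u hu k hk')).2]
        exact hs.left u hu k hk hk'
      · rw [Nat.succ_mul, hi.dual k hk hk']
        simp only [arrays, rows, if_neg hD]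
    · rw [hi.row k hk hk']
      simp only [arrays, rows, if_neg hD]

theorem runs_stage {s : State} (hn : Fits n w) (hl : Layout n (posLeft n F o) (posRight n F o))
    {t : ℕ} (ht : t < n) (hc : Consts n F E o s) (h7 : s.reg 7 = t) (hs : Stored n F E o t s)
    (hb : BestSoFar n F E o t s) :
    Runs n w stage s fun s' =>
      s'.reg 7 = t + 1 ∧ Stored n F E o (t + 1) s' ∧ BestSoFar n F E o (t + 1) s' := by
  have hsmall := hn.small
  have haddress := hn.address ht
  refine Runs.seq (Runs.load (Runs.seq ((runs_locate (n := n) (by simp [hc.r0]) (by simp [hc.r1])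
    (by omega)).mono ?_)))
  simp only [State.setReg_rmem, State.setReg_reg, if_true, hc.foot, hc.free, h7, hc.order]
  rintro s1 ⟨g9, g10, g11, g12, gr0, gr1⟩ f1
  have c1 : Consts n F E o s1 := (hc.setReg (by norm_num)).frame f1 rfl rfl rfl rfl rfl rfl
  have m1 : s1.mem = s.mem := by
    funext A; rw [f1.mem A rfl]; rfl
  have e14 : s1.reg 14 = t * (n + 1) := by rw [f1.reg 14 rfl]; simp [hs.base]
  have e7 : s1.reg 7 = t := by rw [f1.reg 7 rfl]; simp [h7]
  have e19 : ∀ r, r = 19 ∨ r = 20 ∨ r = 21 ∨ r = 22 ∨ r = 27 → s1.reg r = s.reg r := by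
    rintro r (rfl | rfl | rfl | rfl | rfl) <;> rw [f1.reg _ rfl] <;> simp
  refine Runs.seq (Runs.add ?_ (Runs.seq ((runs_insertStage hn hl ht (c1.setReg (by norm_num))
    ⟨by simp [e14], ?_, ?_, ?_⟩ ?_ ?_ ?_ ?_).mono ?_)))
  · rw [e14, c1.r2]; omega
  · simpa [m1] using hs.left
  · simpa [m1] using hs.right
  · simpa [m1] using hs.fresh
  · simp [g9, posLeft]
  · simp [g10, posRight]
  · simp [e14, c1.r2]
  · simp [Cond.holds, gr0, gr1, TurnsRight]
  rintro s2 ⟨l2, r2, fr2⟩ f2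
  have c2 : Consts n F E o s2 := (c1.setReg (by norm_num)).frame f2 rfl rfl rfl rfl rfl rfl
  have k15 : s2.reg 15 = (t + 1) * (n + 1) := by
    rw [f2.reg 15 rfl, Nat.succ_mul]; simp [e14, c1.r2]
  have k11 : s2.reg 11 = cutLeft n F E (o t) := by rw [f2.reg 11 rfl]; simp [g11]
  have k12 : s2.reg 12 = cutRight n F E (o t) := by rw [f2.reg 12 rfl]; simp [g12]
  have k7 : s2.reg 7 = t := by rw [f2.reg 7 rfl]; simp [e7]
  have k19 : ∀ r, r = 19 ∨ r = 20 ∨ r = 21 ∨ r = 22 ∨ r = 27 → s2.reg r = s.reg r := by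
    intro r hr
    rw [← e19 r hr]
    rcases hr with rfl | rfl | rfl | rfl | rfl <;> rw [f2.reg _ rfl] <;> simp
  refine Runs.seq (Runs.move (Runs.seq (Runs.move (Runs.seq ((runs_countRow (n := n)
    (A := (arrays n F E o (t + 1)).1)
    (by norm_num) (by simp [c2.r0]) (by simp [c2.r1]) rfl ?_ (by omega) ?_ ?_).mono ?_)))))
  · simp [k15]; rw [Nat.succ_mul]; omega
  · simp [k12]; exact countAbove_le _ _ _
  · simpa [k15] using l2 (t + 1) le_rfl
  simp only [State.setReg_reg]
  norm_num
  rw [k11, k12]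
  intro s3 g8 f3
  have c3 : Consts n F E o s3 :=
    ((c2.setReg (by norm_num)).setReg (by norm_num)).frame f3 rfl rfl rfl rfl rfl rfl
  have m3 : s3.mem = s2.mem := by funext A; rw [f3.mem A rfl]; rfl
  have j15 : s3.reg 15 = (t + 1) * (n + 1) := by rw [f3.reg 15 rfl]; simp [k15]
  have j11 : s3.reg 11 = cutLeft n F E (o t) := by rw [f3.reg 11 rfl]; simp [k11]
  have j12 : s3.reg 12 = cutRight n F E (o t) := by rw [f3.reg 12 rfl]; simp [k12]
  have j7 : s3.reg 7 = t := by rw [f3.reg 7 rfl]; simp [k7]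
  have j19 : ∀ r, r = 19 ∨ r = 20 ∨ r = 21 ∨ r = 22 ∨ r = 27 → s3.reg r = s.reg r := by
    intro r hr
    rw [← k19 r hr]
    rcases hr with rfl | rfl | rfl | rfl | rfl <;> rw [f3.reg _ rfl] <;> simp
  -- The row after the insertion of `t`, evaluated in the window of `t`, is by definition the clique
  -- size of stage `t`.
  change s3.reg 8 = cliqueSize n F E o t at g8
  have fin : ∀ s4 : State, s4.reg 1 = 1 → s4.reg 7 = t → s4.reg 15 = (t + 1) * (n + 1) →
      s4.mem = s3.mem → BestSoFar n F E o (t + 1) s4 →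
      Runs n w (.instr (.move 14 15) ;; inc 7) s4 fun s' =>
        s'.reg 7 = t + 1 ∧ Stored n F E o (t + 1) s' ∧ BestSoFar n F E o (t + 1) s' := by
    intro s4 i1 i7 i15 im ib
    refine Runs.seq (Runs.move (Runs.add ?_ ?_))
    · simp [i1, i7]; omega
    · refine ⟨by simp [i1, i7], ⟨by simp [i15], ?_, ?_, ?_⟩, ⟨?_, ?_⟩⟩
      · simpa [im, m3] using l2
      · simpa [im, m3] using r2
      · simpa [im, m3] using fr2
      · simpa using ib.le
      · simpa using ib.eq
  refine Runs.seq (Runs.ite (fun h => Runs.seq (Runs.move (Runs.seq (Runs.move (Runs.seq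
    (Runs.move (Runs.seq (Runs.add ?_ (Runs.move ?_))))))))) (fun h => Runs.nop ?_))
  · simp [j7, c3.r1]; omega
  · simp only [Cond.holds, g8, j19 19 (by norm_num)] at h
    refine fin _ (by simp [c3.r1]) (by simp [j7]) (by simp [j15]) rfl ⟨?_, ?_⟩
    · intro u hu
      simp only [State.setReg_reg]
      norm_num
      rw [g8]
      rcases Nat.lt_succ_iff_lt_or_eq.1 hu with hu | rfl
      · exact (hb.le u hu).trans h.le
      · exact le_rfl
    · right
      exact ⟨t, by omega, by simp [g8], by simp [j11], by simp [j12], by simp [j7, c3.r1],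
        by simp [j15]⟩
  · simp only [Cond.holds, g8, j19 19 (by norm_num), not_lt] at h
    refine fin _ c3.r1 j7 j15 rfl ⟨?_, ?_⟩
    · intro u hu
      rw [j19 19 (by norm_num)]
      rcases Nat.lt_succ_iff_lt_or_eq.1 hu with hu | rfl
      · exact hb.le u hu
      · exact h
    · rw [j19 19 (by norm_num), j19 20 (by norm_num), j19 21 (by norm_num), j19 22 (by norm_num),
        j19 27 (by norm_num)]
      rcases hb.eq with he | ⟨u, hu, he⟩
      · exact Or.inl he
      · exact Or.inr ⟨u, by omega, he⟩

theorem runs_stages {s : State} (hn : Fits n w) (hl : Layout n (posLeft n F o) (posRight n F o))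
    (hc : Consts n F E o s) (hs : Stored n F E o 0 s) (hb : BestSoFar n F E o 0 s) :
    Runs n w stages s fun s' => Stored n F E o n s' ∧ BestSoFar n F E o n s' := by
  have hsmall := hn.small
  refine Runs.seq (Runs.const (by omega) ?_)
  refine (Runs.loop n le_rfl (fun t s' => s'.reg 7 = t ∧ Stored n F E o t s' ∧
    BestSoFar n F E o t s') ?_ ?_ ?_).mono ?_
  · exact ⟨by simp, ⟨by simpa using hs.base, by simpa using hs.left, by simpa using hs.right,
      by simpa using hs.fresh⟩, ⟨by simp, by simpa using hb.eq⟩⟩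
  · rintro t ht s0 f0 ⟨h7, hs0, hb0⟩
    have c0 : Consts n F E o s0 := (hc.setReg (by norm_num)).frame f0 rfl rfl rfl rfl rfl rfl
    exact ⟨by simp [Cond.holds, h7, c0.r0, ht], runs_stage hn hl ht c0 h7 hs0 hb0⟩
  · rintro s0 f0 ⟨h7, -, -⟩
    have c0 : Consts n F E o s0 := (hc.setReg (by norm_num)).frame f0 rfl rfl rfl rfl rfl rfl
    simp [Cond.holds, h7, c0.r0]
  · rintro s' ⟨-, h⟩ -
    exact h

end RAM

/-! ### Backtracking, word size and total cost. -/

namespace RAM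

open NestedWindow

variable {n w : ℕ} {F E : ℕ → ℝ} {o : ℕ → ℕ}

/-- The elements of the clique that remain to be found before stage `t` in a window. -/
noncomputable def remaining (n : ℕ) (F E : ℕ → ℝ) (o : ℕ → ℕ) (t a b : ℕ) : List ℕ :=
  (back n (posLeft n F o) (posRight n F o) (TurnsRight F E o) t a b).map o

/-- The state of `backtrack` when the stages from `t` on have been processed. -/
structure BackInv (n : ℕ) (F E : ℕ → ℝ) (o : ℕ → ℕ) (L : List ℕ) (t : ℕ) (s : State) : Prop where
  stage : s.reg 7 = t
  base : s.reg 15 = t * (n + 1)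
  le : s.reg 24 ≤ n
  split : ∃ K : List ℕ, s.reg 25 = K.length ∧ (∀ (j : ℕ) (h : j < K.length), s.mem 0 j = K[j]) ∧
    K ++ remaining n F E o t (s.reg 23) (s.reg 24) = L

-- The test in `back` compares the values of two consecutive stored rows in the same window, so it
-- can be repeated without storing any decision. Throughout, the list `K` already written followed
-- by `remaining` is the fixed target `L`.
open Classical in
theorem runs_backStep {s : State} (hn : Fits n w) {L : List ℕ} (hL : L.length ≤ n)
    (hl : Layout n (posLeft n F o) (posRight n F o))
    (hc : Consts n F E o s) (hs : ∀ u ≤ n, ∀ k, 1 ≤ k → k ≤ n →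
      s.mem 1 (u * (n + 1) + k) = (arrays n F E o u).1 k)
    {t : ℕ} (ht : t < n) (hi : BackInv n F E o L (t + 1) s) :
    Runs n w backStep s (BackInv n F E o L t) := by
  have hsmall := hn.small
  have haddress := hn.address ht
  have h15 := hi.base
  have h7 := hi.stage
  have h24 := hi.le
  obtain ⟨K, h25, hK, hKL⟩ := hi.split
  rw [Nat.succ_mul] at h15
  refine Runs.seq (Runs.sub ?_ ?_ (Runs.seq ((runs_countRow (n := n)
    (A := (arrays n F E o (t + 1)).1) (by norm_num) (by simp [hc.r0]) (by simp [hc.r1]) rfl ?_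
    (by omega) ?_ ?_).mono ?_)))
  · rw [h15, hc.r2]; omega
  · rw [h15]; omega
  · simp [h15]; omega
  · simpa using h24
  · have := hs (t + 1) ht
    rw [Nat.succ_mul] at this
    simpa [h15] using this
  simp only [State.setReg_reg]
  norm_num
  intro s1 g8 f1
  have c1 : Consts n F E o s1 := (hc.setReg (by norm_num)).frame f1 rfl rfl rfl rfl rfl rfl
  have m1 : s1.mem = s.mem := by funext A; rw [f1.mem A rfl]; rfl
  have e7 : s1.reg 7 = t + 1 := by rw [f1.reg 7 rfl]; simp [h7]
  have e14 : s1.reg 14 = t * (n + 1) := by rw [f1.reg 14 rfl]; simp [h15, hc.r2]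
  have e23 : s1.reg 23 = s.reg 23 := by rw [f1.reg 23 rfl]; simp
  have e24 : s1.reg 24 = s.reg 24 := by rw [f1.reg 24 rfl]; simp
  have e25 : s1.reg 25 = K.length := by rw [f1.reg 25 rfl]; simp [h25]
  refine Runs.seq (Runs.move (Runs.seq ((runs_countRow (n := n)
    (A := (arrays n F E o t).1) (by norm_num) (by simp [c1.r0]) (by simp [c1.r1]) rfl ?_
    (by omega) ?_ ?_).mono ?_)))
  · simp [e14]; omega
  · simpa [e24] using h24
  · simpa [e14, m1] using hs t ht.le
  simp only [State.setReg_reg]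
  norm_num
  rw [e23, e24]
  intro s2 k8 f2
  have c2 : Consts n F E o s2 := (c1.setReg (by norm_num)).frame f2 rfl rfl rfl rfl rfl rfl
  have m2 : s2.mem = s.mem := by funext A; rw [f2.mem A rfl, ← m1]; rfl
  have k26 : s2.reg 26 = cnt n (arrays n F E o (t + 1)).1 (s.reg 23) (s.reg 24) := by
    rw [f2.reg 26 rfl]; simp [g8]
  have k7 : s2.reg 7 = t + 1 := by rw [f2.reg 7 rfl]; simp [e7]
  have k14 : s2.reg 14 = t * (n + 1) := by rw [f2.reg 14 rfl]; simp [e14]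
  have k23 : s2.reg 23 = s.reg 23 := by rw [f2.reg 23 rfl]; simp [e23]
  have k24 : s2.reg 24 = s.reg 24 := by rw [f2.reg 24 rfl]; simp [e24]
  have k25 : s2.reg 25 = K.length := by rw [f2.reg 25 rfl]; simp [e25]
  change s2.reg 26 = best n (posLeft n F o) (posRight n F o) (TurnsRight F E o) (t + 1) _ _ at k26
  change s2.reg 8 = best n (posLeft n F o) (posRight n F o) (TurnsRight F E o) t _ _ at k8
  refine Runs.seq (Runs.sub ?_ ?_ (Runs.seq ?_))
  · simp [k7, c2.r1]
  · simp [k7]; omega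
  refine Runs.ite (fun h => Runs.nop (Runs.move ?_)) (fun h => ?_)
  · simp [Cond.holds, k26, k8] at h
    refine ⟨by simp [k7, c2.r1], by simp [k14], by simpa [k24] using h24, K, by simp [k25], ?_, ?_⟩
    · simpa [m2] using hK
    · rw [← hKL]
      simp [remaining, back, h, k23, k24]
  · simp [Cond.holds, k26, k8] at h
    have hrem : remaining n F E o (t + 1) (s.reg 23) (s.reg 24) =
        o t :: remaining n F E o t (if TurnsRight F E o t then posLeft n F o t else s.reg 23)
          (if TurnsRight F E o t then s.reg 24 else posRight n F o t) := by
      simp only [remaining, back, if_neg h, List.map_cons]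
    rw [hrem] at hKL
    have hKlen : K.length < L.length := by
      rw [← hKL, List.length_append, List.length_cons]; omega
    refine Runs.seq (Runs.load (Runs.seq (Runs.store (Runs.seq (Runs.add ?_ (Runs.seq
      ((runs_locate (n := n) (by simp [c2.r0]) (by simp [c2.r1]) (by omega)).mono ?_)))))))
    · simp [k25, c2.r1]; omega
    simp only [State.setReg_rmem, State.setMem_rmem, State.setReg_reg, State.setMem_reg, c2.foot,
      c2.free]
    norm_num
    have km : s2.mem 3 (s2.reg 7 - s2.reg 1) = o t := by rw [k7, c2.r1, c2.order]; rfl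
    rw [km]
    intro s3 j9 j10 _ _ jr0 jr1 f3
    have j7 : s3.reg 7 = t := by rw [f3.reg 7 rfl]; simp [k7, c2.r1]
    have j14 : s3.reg 14 = t * (n + 1) := by rw [f3.reg 14 rfl]; simp [k14]
    have j23 : s3.reg 23 = s.reg 23 := by rw [f3.reg 23 rfl]; simp [k23]
    have j24 : s3.reg 24 = s.reg 24 := by rw [f3.reg 24 rfl]; simp [k24]
    have j25 : s3.reg 25 = (K ++ [o t]).length := by rw [f3.reg 25 rfl]; simp [k25, c2.r1]
    have jm : ∀ (j : ℕ) (h : j < (K ++ [o t]).length), s3.mem 0 j = (K ++ [o t])[j] := by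
      intro j hj
      rw [f3.mem 0 rfl]
      simp only [State.setReg_mem, State.setMem_mem, m2]
      norm_num
      rw [k25, List.getElem_append]
      rw [List.length_append, List.length_singleton] at hj
      by_cases hjK : j < K.length
      · simp [hjK, hjK.ne, hK j hjK]
      · simp [show j = K.length by omega]
    have hdir : (Cond.rlt 0 1).holds s3 ↔ TurnsRight F E o t := by
      simp [Cond.holds, jr0, jr1, TurnsRight]
    have hadd := hl.add t ht
    have hpl := hl.left_pos t ht
    refine Runs.ite (fun hd => Runs.move (Runs.move ?_)) (fun hd => Runs.move (Runs.move ?_))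
    · rw [hdir] at hd
      refine ⟨by simp [j7], by simp [j14], by simpa [j24] using h24, K ++ [o t], by simpa using j25,
        by simpa using jm, ?_⟩
      rw [← hKL, if_pos hd, if_pos hd]
      simp [j9, j24, posLeft]
    · rw [hdir] at hd
      have j10' : s3.reg 10 = posRight n F o t := j10
      refine ⟨by simp [j7], by simp [j14], by simp [j10']; omega, K ++ [o t], by simpa using j25,
        by simpa using jm, ?_⟩
      rw [← hKL, if_neg hd, if_neg hd]
      simp [j10', j23]

theorem runs_backtrack {s : State} (hn : Fits n w)
    (hl : Layout n (posLeft n F o) (posRight n F o))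
    (hc : Consts n F E o s) (hs : Stored n F E o n s) (hb : BestSoFar n F E o n s) :
    Runs n w backtrack s fun s' => ∃ L : List ℕ, s'.reg 25 = L.length ∧
      (∀ (j : ℕ) (h : j < L.length), s'.mem 0 j = L[j]) ∧
      (∀ u < n, cliqueSize n F E o u ≤ L.length) ∧
      (L = [] ∨ ∃ u < n, L = cliqueList n F E o u) := by
  have hsmall := hn.small
  refine Runs.seq (Runs.move (Runs.seq (Runs.move (Runs.seq (Runs.move (Runs.seq (Runs.move
    (Runs.seq (Runs.const (by omega) ?_)))))))))
  have main : ∀ s₀ : State, Consts n F E o s₀ → (∀ u ≤ n, ∀ k, 1 ≤ k → k ≤ n →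
      s₀.mem 1 (u * (n + 1) + k) = (arrays n F E o u).1 k) → ∀ L : List ℕ, L.length ≤ n →
      ∀ t ≤ n, (t = 0 → s₀.reg 7 = 0 ∧ s₀.reg 25 = 0 ∧ L = []) →
      (t ≠ 0 → BackInv n F E o L t s₀) →
      Runs n w (.loop (.lt 3 7) backStep) s₀ fun s' => s'.reg 25 = L.length ∧
        (∀ (j : ℕ) (h : j < L.length), s'.mem 0 j = L[j]) := by
    intro s₀ c₀ hs₀ L hL t ht hz hi
    rcases Nat.eq_zero_or_pos t with rfl | htpos
    · obtain ⟨h1, h2, rfl⟩ := hz rfl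
      refine (Runs.loop 0 (Nat.zero_le _) (fun _ s' => s'.reg 25 = 0 ∧ s'.reg 7 = 0) ⟨h2, h1⟩
        (fun i hi => absurd hi (Nat.not_lt_zero _)) ?_).mono ?_
      · rintro s' f ⟨-, h⟩
        simp [Cond.holds, h]
      · rintro s' ⟨h, -⟩ -
        exact ⟨h, fun j hj => absurd hj (Nat.not_lt_zero _)⟩
    · refine (Runs.loop t ht (fun i => BackInv n F E o L (t - i)) (hi htpos.ne') ?_ ?_).mono ?_
      · intro i hit s1 f1 hi1
        have c1 : Consts n F E o s1 := c₀.frame f1 rfl rfl rfl rfl rfl rfl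
        obtain ⟨u, hu⟩ : ∃ u, t - i = u + 1 := ⟨t - i - 1, by omega⟩
        rw [hu] at hi1
        rw [show t - (i + 1) = u by omega]
        refine ⟨by simp [Cond.holds, c1.r3, hi1.stage], runs_backStep hn hL hl c1 ?_ (by omega) hi1⟩
        rw [f1.mem 1 rfl]
        exact hs₀
      · intro s1 f1 hi1
        have c1 : Consts n F E o s1 := c₀.frame f1 rfl rfl rfl rfl rfl rfl
        have := hi1.stage
        simp [Cond.holds, c1.r3, this]
      · intro s1 hi1 _
        rw [Nat.sub_self] at hi1
        obtain ⟨K, h1, h2, h3⟩ := hi1.split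
        rw [remaining, back, List.map_nil, List.append_nil] at h3
        subst h3
        exact ⟨h1, h2⟩
  have hconst : Consts n F E o (((((s.setReg 7 (s.reg 22)).setReg 23 (s.reg 20)).setReg 24
      (s.reg 21)).setReg 15 (s.reg 27)).setReg 25 0) :=
    ((((hc.setReg (by norm_num)).setReg (by norm_num)).setReg (by norm_num)).setReg
      (by norm_num)).setReg (by norm_num)
  -- In the first case no stage has exceeded `0`; the stage register is `0`, the loop is not
  -- entered, and the empty list is optimal.
  rcases hb.eq with ⟨h19, h22⟩ | ⟨u, hu, h19, h20, h21, h22, h27⟩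
  · refine (main _ hconst (by simpa using hs.left) [] (Nat.zero_le _) 0 (Nat.zero_le _)
      (fun _ => ⟨by simp [h22], by simp, rfl⟩) (fun h => absurd rfl h)).mono ?_
    rintro s' ⟨h1, h2⟩ -
    refine ⟨[], h1, h2, fun u hu => ?_, Or.inl rfl⟩
    have := hb.le u hu
    simpa [h19] using this
  · have hlen : (cliqueList n F E o u).length = cliqueSize n F E o u := by
      rw [cliqueList, List.length_map, (back_spec hl (u + 1) hu _ _).1]; rfl
    have hle : cliqueSize n F E o u ≤ n := Nat.count_le _
    refine (main _ hconst (by simpa using hs.left) (cliqueList n F E o u) (by omega) (u + 1) hu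
      (fun h => absurd h (Nat.succ_ne_zero _)) (fun _ => ⟨by simp [h22], by simp [h27], ?_, [],
        by simp, by simp, ?_⟩)).mono ?_
    · simp [h21, cutRight, countAbove_le]
    · simp [remaining, cliqueList, h20, h21]
    · rintro s' ⟨h1, h2⟩ -
      refine ⟨_, h1, h2, fun v hv => ?_, Or.inr ⟨u, hu, rfl⟩⟩
      rw [hlen, ← h19]
      exact hb.le v hv

theorem runs_maxClique {s : State} (hn : Fits n w) (h0 : s.reg 0 = n) (hr : ∀ r, r ≠ 0 → s.reg r = 0)
    (hm : ∀ A i, s.mem A i = 0) {H : ℕ → ℝ} (hF : s.rmem 0 = F) (hH : s.rmem 1 = H)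
    (hE : s.rmem 2 = E) (hfam : Family n F H E) :
    Runs n w maxClique s fun s' => ∃ o, Sorts n H o ∧ ∃ L : List ℕ, s'.reg 0 = L.length ∧
      (∀ (j : ℕ) (h : j < L.length), s'.mem 0 j = L[j]) ∧
      (∀ u < n, cliqueSize n F E o u ≤ L.length) ∧
      (L = [] ∨ ∃ u < n, L = cliqueList n F E o u) := by
  have hsmall := hn.small
  refine Runs.seq (Runs.const (by omega) (Runs.seq (Runs.add ?_ (Runs.seq ((runs_sortHeights
    (n := n) (by simp [h0]) (by simp) (by omega) ?_).mono ?_)))))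
  · simp [h0]; omega
  · simpa [hH] using hfam.height_inj
  simp only [State.setReg_rmem, hH]
  intro s1 hsort f1
  have hl := layout hfam hsort
  have c1 : Consts n F E (s1.mem 3) s1 :=
    ⟨by rw [f1.reg 0 rfl]; simp [h0], by rw [f1.reg 1 rfl]; simp,
      by rw [f1.reg 2 rfl]; simp [h0], by rw [f1.reg 3 rfl]; simp [hr],
      by rw [f1.rmem rfl]; simp [hF], by rw [f1.rmem rfl]; simp [hE], rfl⟩
  generalize s1.mem 3 = o at hsort hl c1
  have hr1 : ∀ r, r = 14 ∨ r = 19 ∨ r = 22 → s1.reg r = 0 := by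
    rintro r (rfl | rfl | rfl) <;> rw [f1.reg _ rfl] <;> simp [hr]
  refine Runs.seq ((runs_initRows c1.r0 c1.r1 (by omega) ?_).mono ?_)
  · intro j
    rw [f1.mem 1 rfl, f1.mem 2 rfl]
    simp [hm]
  rintro s2 ⟨hrow, hfresh⟩ f2
  have c2 : Consts n F E o s2 := c1.frame f2 rfl rfl rfl rfl rfl rfl
  refine Runs.seq ((runs_stages hn hl c2 ⟨?_, ?_, ?_, ?_⟩ ⟨?_, Or.inl ⟨?_, ?_⟩⟩).mono ?_)
  · rw [f2.reg 14 rfl, hr1 14 (by norm_num), Nat.zero_mul]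
  · intro u hu k hk hk'
    obtain rfl : u = 0 := by omega
    rw [Nat.zero_mul, Nat.zero_add, (hrow k hk hk').1]; rfl
  · intro k hk hk'
    rw [Nat.zero_mul, Nat.zero_add, (hrow k hk hk').2]; rfl
  · intro j hj
    exact hfresh j (by omega)
  · exact fun u hu => absurd hu (Nat.not_lt_zero _)
  · rw [f2.reg 19 rfl, hr1 19 (by norm_num)]
  · rw [f2.reg 22 rfl, hr1 22 (by norm_num)]
  rintro s3 ⟨hst, hbest⟩ f3
  have c3 : Consts n F E o s3 := c2.frame f3 rfl rfl rfl rfl rfl rfl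
  refine Runs.seq ((runs_backtrack hn hl c3 hst hbest).mono ?_)
  rintro s4 ⟨L, h1, h2, h3, h4⟩ -
  exact Runs.move ⟨o, hsort, L, by simp [h1], by simpa using h2, h3, h4⟩

/-- With `x = 2 ^ (Nat.log 2 n + 1)`, both summands in `Fits` are at most `x ^ 2`, and `2 * x ^ 2 <
4 * x ^ 2 ≤ x ^ 4 ≤ 2 ^ w`. -/
theorem fits_of_le {n w : ℕ} (h : 4 * (Nat.log 2 n + 1) ≤ w) : Fits n w := by
  have h1 : n + 1 ≤ 2 ^ (Nat.log 2 n + 1) := Nat.lt_pow_succ_log_self (by norm_num) n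
  have h2 : 2 ≤ 2 ^ (Nat.log 2 n + 1) := by
    rw [pow_succ]; have := Nat.one_le_two_pow (n := Nat.log 2 n); omega
  have h3 : (2 ^ (Nat.log 2 n + 1)) ^ 4 ≤ 2 ^ w := by
    rw [← pow_mul, mul_comm]
    exact Nat.pow_le_pow_right (by norm_num) h
  generalize 2 ^ (Nat.log 2 n + 1) = x at h1 h2 h3
  have h4 : (n + 1) * (n + 1) ≤ x * x := Nat.mul_le_mul h1 h1
  have h5 : 2 * (n + 1) ≤ x * x := Nat.mul_le_mul h2 h1
  have h6 : 4 ≤ x * x := Nat.mul_le_mul h2 h2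
  have h7 : x ^ 4 = (x * x) * (x * x) := by ring
  have h8 : 4 * (x * x) ≤ (x * x) * (x * x) := Nat.mul_le_mul_right _ h6
  unfold Fits
  omega

/-- A program of cost `O(n ^ 2)` runs in time `O(n ^ 2 log log n)`. -/
theorem isBigO_cost {p : Program} (hp : p.depth = 2) :
    (fun n : ℕ => (p.cost n : ℝ)) =O[atTop]
      (fun n : ℕ => (n : ℝ) ^ 2 * Real.log (Real.log (n : ℝ))) := by
  obtain ⟨K, hK⟩ := p.exists_cost_le
  rw [hp] at hK
  -- The iterated logarithm is used only as a factor that is eventually at least `1`.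
  have hlog : ∀ᶠ n : ℕ in atTop, 1 ≤ Real.log (Real.log (n : ℝ)) :=
    ((Real.tendsto_log_atTop.comp Real.tendsto_log_atTop).comp
      tendsto_natCast_atTop_atTop).eventually_ge_atTop 1
  refine IsBigO.of_bound (4 * K) ?_
  filter_upwards [hlog, eventually_ge_atTop 1] with n h1 h2
  have h3 : (p.cost n : ℝ) ≤ K * ((n : ℝ) + 1) ^ 2 := by exact_mod_cast hK n
  have h4 : (1 : ℝ) ≤ n := by exact_mod_cast h2
  have h5 : ((n : ℝ) + 1) ^ 2 ≤ 4 * (n : ℝ) ^ 2 := by nlinarith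
  rw [Real.norm_of_nonneg (Nat.cast_nonneg _), Real.norm_of_nonneg (by positivity)]
  calc (p.cost n : ℝ) ≤ K * (4 * (n : ℝ) ^ 2) :=
        h3.trans (mul_le_mul_of_nonneg_left h5 (Nat.cast_nonneg _))
    _ = 4 * K * ((n : ℝ) ^ 2 * 1) := by ring
    _ ≤ 4 * K * ((n : ℝ) ^ 2 * Real.log (Real.log (n : ℝ))) := by gcongr

end RAM

/-! ### From the machine's output to maximum cliques of the intersection graph. -/

namespace GroundedL

open NestedWindow

variable {n : ℕ} {S : Fin n → GroundedL}

theorem input_rmem (i : Fin n) : (RAM.input S).rmem 0 i = (S i).foot ∧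
    (RAM.input S).rmem 1 i = (S i).height ∧ (RAM.input S).rmem 2 i = (S i).free := by
  simp [RAM.input]

theorem family_input (hsq : ∀ i, (S i).IsSquare) (hgp : GeneralPosition S) :
    Family n ((RAM.input S).rmem 0) ((RAM.input S).rmem 1) ((RAM.input S).rmem 2) := by
  have h := input_rmem (S := S)
  refine ⟨fun i hi => ?_, fun i hi => ?_, fun i j hi hj e => ?_, fun i j hi hj e => ?_⟩
  · rw [(h ⟨i, hi⟩).1, (h ⟨i, hi⟩).2.2]; exact (S ⟨i, hi⟩).free_ne_foot
  · rw [(h ⟨i, hi⟩).1, (h ⟨i, hi⟩).2.1, (h ⟨i, hi⟩).2.2]; exact hsq _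
  · rw [(h ⟨i, hi⟩).1, (h ⟨j, hj⟩).1] at e
    by_contra hne
    exact (hgp ⟨i, hi⟩ ⟨j, hj⟩ (by simpa using hne)).1 e
  · rw [(h ⟨i, hi⟩).2.1, (h ⟨j, hj⟩).2.1] at e
    by_contra hne
    exact (hgp ⟨i, hi⟩ ⟨j, hj⟩ (by simpa using hne)).2 e

theorem adj_iff_meets (hgp : GeneralPosition S) {i j : Fin n} (h : (S i).height < (S j).height) :
    (intersectionGraph S).Adj i j ↔
      Meets ((RAM.input S).rmem 0) ((RAM.input S).rmem 2) i j := by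
  have hne : i ≠ j := fun e => by rw [e] at h; exact lt_irrefl _ h
  unfold Meets
  rw [(input_rmem i).1, (input_rmem j).1, (input_rmem i).2.2,
    ← inter_nonempty_iff (hgp i j hne).1 h]
  exact and_iff_right hne

/-- Heights are distinct, so every pair can be tested from its lower member. -/
theorem isClique_iff (hgp : GeneralPosition S) (Q : Finset (Fin n)) :
    (intersectionGraph S).IsClique Q ↔ ∀ i ∈ Q, ∀ j ∈ Q, (S i).height < (S j).height →
      Meets ((RAM.input S).rmem 0) ((RAM.input S).rmem 2) i j := by
  constructor
  · intro h i hi j hj hij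
    rw [← adj_iff_meets hgp hij]
    exact h hi hj fun e => by rw [e] at hij; exact lt_irrefl _ hij
  · intro h i hi j hj hne
    rcases lt_or_gt_of_ne (hgp i j hne).2 with hij | hij
    · exact (adj_iff_meets hgp hij).2 (h i hi j hj hij)
    · exact ((adj_iff_meets hgp hij).2 (h j hj i hi hij)).symm

end GroundedL

open NestedWindow in
theorem RAM.exists_outputs {n : ℕ} {S : Fin n → GroundedL} (hsq : ∀ i, (S i).IsSquare)
    (hgp : GroundedL.GeneralPosition S) {w : ℕ} (hw : 4 * (Nat.log 2 n + 1) ≤ w) :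
    RAM.Runs n w RAM.maxClique (RAM.input S) fun s => ∃ Q : Finset (Fin n),
      RAM.Outputs s Q ∧ (GroundedL.intersectionGraph S).IsMaximumClique Q := by
  have hfam := GroundedL.family_input hsq hgp
  refine (RAM.runs_maxClique (RAM.fits_of_le hw) (by simp [RAM.input])
    (fun r hr => by simp [RAM.input, hr]) (fun _ _ => rfl) rfl rfl rfl hfam).mono ?_
  rintro s ⟨o, hsort, L, h0, hmem, hmax, hL⟩ -
  have hspec : L.Nodup ∧ (∀ i ∈ L, i < n) ∧ ∀ i ∈ L, ∀ j ∈ L,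
      (RAM.input S).rmem 1 i < (RAM.input S).rmem 1 j →
      Meets ((RAM.input S).rmem 0) ((RAM.input S).rmem 2) i j := by
    rcases hL with rfl | ⟨u, hu, rfl⟩
    · simp
    · exact (cliqueList_spec hfam hsort hu).2
  obtain ⟨hnd, hlt, hmeet⟩ := hspec
  have himg : (Finset.univ.filter fun i : Fin n => i.val ∈ L).image Fin.val = L.toFinset := by
    ext i
    simp only [Finset.mem_image, Finset.mem_filter, Finset.mem_univ, true_and, List.mem_toFinset]
    constructor
    · rintro ⟨j, hj, rfl⟩; exact hj
    · exact fun hi => ⟨⟨i, hlt i hi⟩, hi, rfl⟩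
  have hcard : (Finset.univ.filter fun i : Fin n => i.val ∈ L).card = L.length := by
    rw [← Finset.card_image_of_injective _ Fin.val_injective, himg,
      List.toFinset_card_of_nodup hnd]
  refine ⟨Finset.univ.filter fun i : Fin n => i.val ∈ L, ⟨by rw [hcard, h0], ?_⟩, ?_, ?_⟩
  · rw [hcard, himg]
    ext i
    simp only [Finset.mem_image, Finset.mem_range, List.mem_toFinset, List.mem_iff_getElem]
    constructor
    · rintro ⟨j, hj, rfl⟩; exact ⟨j, hj, (hmem j hj).symm⟩
    · rintro ⟨j, hj, rfl⟩; exact ⟨j, hj, hmem j hj⟩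
  · rw [GroundedL.isClique_iff hgp]
    intro i hi j hj hij
    rw [← (GroundedL.input_rmem i).2.1, ← (GroundedL.input_rmem j).2.1] at hij
    exact hmeet i (Finset.mem_filter.1 hi).2 j (Finset.mem_filter.1 hj).2 hij
  · intro K hK
    rw [GroundedL.isClique_iff hgp] at hK
    rw [hcard]
    rcases K.eq_empty_or_nonempty with rfl | hne
    · simp
    obtain ⟨t, ht, hle⟩ := card_le_cliqueSize hfam hsort (K.image Fin.val)
      (fun i hi => by obtain ⟨j, -, rfl⟩ := Finset.mem_image.1 hi; exact j.2)
      (fun i hi j hj hij => by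
        obtain ⟨i, hi', rfl⟩ := Finset.mem_image.1 hi
        obtain ⟨j, hj', rfl⟩ := Finset.mem_image.1 hj
        rw [(GroundedL.input_rmem i).2.1, (GroundedL.input_rmem j).2.1] at hij
        exact hK i hi' j hj' hij) (hne.image _)
    rw [Finset.card_image_of_injective _ Fin.val_injective] at hle
    exact hle.trans (hmax t ht)

theorem theorem4 :
    ∃ (p : RAM.Program) (κ : ℕ) (T : ℕ → ℕ),
      0 < κ ∧
      (fun n : ℕ => (T n : ℝ)) =O[atTop]
        (fun n : ℕ => (n : ℝ) ^ 2 * Real.log (Real.log (n : ℝ))) ∧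
      ∀ (n : ℕ) (S : Fin n → GroundedL),
        (∀ i, (S i).IsSquare) → GroundedL.GeneralPosition S →
        ∀ w : ℕ, κ * (Nat.log 2 n + 1) ≤ w →
          ∃ (t : ℕ) (s : RAM.State) (Q : Finset (Fin n)),
            RAM.Exec w p (RAM.input S) t s ∧ t ≤ T n ∧
            RAM.Outputs s Q ∧ (GroundedL.intersectionGraph S).IsMaximumClique Q := by
  refine ⟨RAM.maxClique, 4, fun n => RAM.maxClique.cost n, by norm_num, RAM.isBigO_cost rfl, ?_⟩
  intro n S hsq hgp w hw
  obtain ⟨t, s, h1, h2, Q, h3, h4⟩ := RAM.exists_outputs hsq hgp hw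
  exact ⟨t, s, Q, h1, h2, h3, h4⟩
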